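/- Let a social system $x_{k+1}=Ax_k$ on finitely many states $\mathcal X$ have the zero/nonzero pattern of a digraph $\mathcal G=(\mathcal X,\mathcal E)$, where the link $x_i\leftarrow x_j$ is present iff the entry $a_{ij}$ is a free nonzero parameter. Finitely many agents $i=1,\dots,N$ take measurements $y^i=H_ix$, each individual measurement (row of $H_i$) being of a single state with a free nonzero coefficient. Agents share predictions over a directed network $\mathcal G_\beta$ and measurements over a directed network $\mathcal G_\alpha$; $\mathcal N_\beta(i)$ and $\mathcal N_\alpha(i)$ denote the sets consisting of agent $i$ and of the agents that send to $i$ over $\mathcal G_\beta$, respectively $\mathcal G_\alpha$. Let $W=(w_{ij})$ be a row-stochastic matrix with $w_{ij}\neq0$ iff $j\in\mathcal N_\beta(i)$, and let $D_H$ be the block-diagonal matrix with the blocks $\sum_{j\in\mathcal N_\alpha(i)}H_j^\top H_j$, $i=1,\dots,N$. A *parent SCC* is a strongly connected component of $\mathcal G$ without links to states outside of it. In the bipartite graph with the node sets $\mathcal V^+=\mathcal V^-=\mathcal X$ and an edge from $x_j\in\mathcal V^+$ to $x_i\in\mathcal V^-$ for every link $x_i\leftarrow x_j$, a *contraction* is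 a set consisting of all the nodes of $\mathcal V^+$ that can be reached from a node $v\in\mathcal V^+$ unmatched by a maximum matching $\mathcal M$ along $\mathcal M$-alternating paths ($v$ included), for any choice of $\mathcal M$ and $v$. An agent measuring a state in a contraction is called Type-$\alpha$, and one measuring a state in a parent SCC is called Type-$\beta$. Suppose that for every agent $i$: (i) for every contraction $\mathcal C$, some agent $j\in\mathcal N_\alpha(i)$ (that is, $i$ itself or an agent with a direct link to $i$) measures a state in $\mathcal C$; (ii) for every parent SCC $\mathcal S$, some agent $j$ that measures a state in $\mathcal S$ shares predictions with $i$ along directed paths of $\mathcal G_\beta$, from $j$ to $i$ and back from $i$ to $j$ (paths of length $0$ are allowed; if $\mathcal G_\beta$ is strongly connected, or if all of its links are bidirectional and there is a path from $j$ to $i$, such paths exist). Then the pair $(W\otimes A,D_H)$ is structurally observable: it is observable for some values of the nonzero parameters of $A$, $H_1,\dots,H_N$ and $W$ ($W$ stochastic), and in fact for Lebesgue-almost all values of the nonzero entries of $A$ and of $H_1,\dots,H_N$ and of the off-diagonal entries of $W$ on the links of $\mathcal G_\beta$ (the diagonal of $W$ being determined by the unit row sums). -/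

import Mathlib

open Matrix MeasureTheory
open scoped Kronecker

namespace CyberSocial

/-! ### Digraphs

A digraph on `V` is a relation `E : V → V → Prop`, where `E i j` means that there is a link `i ← j`
(for a system digraph: the entry `(i, j)` of the system matrix is a free nonzero parameter; for a
communication network: agent `j` sends information to agent `i`). -/

/-- There is a directed path (possibly of length zero) `x → ⋯ → y` along the links of `E`. -/
def HasPath {V : Type*} (E : V → V → Prop) (x y : V) : Prop :=
  Relation.ReflTransGen (fun a b => E b a) x y

/-- `S` is a strongly connected component of the digraph. -/
def IsSCC {V : Type*} (E : V → V → Prop) (S : Set V) : Prop :=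
  ∃ x, S = {y | HasPath E x y ∧ HasPath E y x}

/-- A parent SCC: a strongly connected component with no outgoing link to a node outside of it. -/
def IsParentSCC {V : Type*} (E : V → V → Prop) (S : Set V) : Prop :=
  IsSCC E S ∧ ∀ y ∈ S, ∀ x, E x y → x ∈ S

/-! ### Matchings and contractions

The bipartite representation has two copies of the node set: `Sum.inl j` stands for the node `j⁺`
and `Sum.inr i` for the node `i⁻`; a link `i ← j` gives the edge from `j⁺` to `i⁻`. An edge is
recorded as the pair `(i, j)`. -/

/-- A set of edges of the bipartite representation no two of which share an end node. -/
def IsMatching {V : Type*} (E : V → V → Prop) (M : Finset (V × V)) : Prop :=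
  (∀ e ∈ M, E e.1 e.2) ∧
    ∀ e ∈ M, ∀ f ∈ M, (e.1 = f.1 ∨ e.2 = f.2) → e = f

/-- A matching of maximum possible size. -/
def IsMaximumMatching {V : Type*} (E : V → V → Prop) (M : Finset (V × V)) : Prop :=
  IsMatching E M ∧ ∀ M', IsMatching E M' → M'.card ≤ M.card

/-- The node `j⁺` is not incident to any edge of `M`. -/
def IsUnmatched {V : Type*} (M : Finset (V × V)) (j : V) : Prop :=
  ∀ e ∈ M, e.2 ≠ j

/-- The directed edges of the auxiliary graph: edges outside `M` keep their direction (from `j⁺`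
to `i⁻`), edges in `M` are reversed (from `i⁻` to `j⁺`). Directed paths in it alternate. -/
inductive AuxEdge {V : Type*} (E : V → V → Prop) (M : Finset (V × V)) : V ⊕ V → V ⊕ V → Prop
  | keep {i j : V} (h : E i j) (hM : (i, j) ∉ M) : AuxEdge E M (Sum.inl j) (Sum.inr i)
  | reverse {i j : V} (hM : (i, j) ∈ M) : AuxEdge E M (Sum.inr i) (Sum.inl j)

/-- The nodes `x⁺` reachable from `v⁺` by `M`-alternating paths (including `v` itself). -/
def alternatingReach {V : Type*} (E : V → V → Prop) (M : Finset (V × V)) (v : V) : Set V :=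
  {x | Relation.ReflTransGen (AuxEdge E M) (Sum.inl v) (Sum.inl x)}

/-- A contraction of the digraph: for some maximum matching `M` and some unmatched node `v`, the
set of the nodes reachable from `v` by `M`-alternating paths. -/
def IsContraction {V : Type*} (E : V → V → Prop) (C : Set V) : Prop :=
  ∃ M, IsMaximumMatching E M ∧ ∃ v, IsUnmatched M v ∧ C = alternatingReach E M v

/-! ### Observability -/

/-- Observability of the pair `(F, G)`: the observability matrix with the blocks
`G, G F, …, G F ^ (card m - 1)` has trivial kernel, i.e. full column rank. -/
def IsObservable {m q : Type*} [Fintype m] [DecidableEq m] (F : Matrix m m ℝ) (G : Matrix q m ℝ) :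
    Prop :=
  ∀ v : m → ℝ, (∀ k < Fintype.card m, (G * F ^ k) *ᵥ v = 0) → v = 0

/-! ### Agents

`ι` is the set of agents. Agent `i` takes `p i` measurements, the `r`-th one of the state `s i r`;
`Gα i j` (`Gβ i j`) says that agent `j` sends its measurements (predictions) to agent `i`. -/

/-- Agent `j` measures a state in `S`. -/
def Measures {ι X : Type*} {p : ι → ℕ} (s : (i : ι) → Fin (p i) → X) (j : ι) (S : Set X) : Prop :=
  ∃ r, s j r ∈ S

/-- The neighborhood of agent `i` (which includes agent `i`). -/
def nbhd {ι : Type*} (G : ι → ι → Prop) (i : ι) : Set ι :=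
  {j | j = i ∨ G i j}

open Classical in
/-- The block diagonal matrix `D_H` whose `i`-th block is the sum of `H_jᵀ H_j` over the agents `j`
in the `Gα`-neighborhood of `i`. -/
noncomputable def DH {ι X : Type*} [Fintype ι] (Gα : ι → ι → Prop) {p : ι → ℕ}
    (H : (i : ι) → Matrix (Fin (p i)) X ℝ) : Matrix (ι × X) (ι × X) ℝ :=
  Matrix.of fun a b =>
    if a.1 = b.1 then
      (∑ j ∈ Finset.univ.filter (fun j => j ∈ nbhd Gα a.1), (H j)ᵀ * H j) a.2 b.2
    else 0

/-! ### Numerical values of the free parameters -/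

open Classical in
/-- The system matrix with the values `a` on the links of `E`, and zeros elsewhere. -/
noncomputable def systemMatrix {X : Type*} (E : X → X → Prop) (a : X → X → ℝ) : Matrix X X ℝ :=
  Matrix.of fun x y => if E x y then a x y else 0

open Classical in
/-- The weight matrix with unit row sums that has the values `w` on the links between different
agents; the weight that an agent gives to itself is determined by the row sum. -/
noncomputable def weightMatrix {ι : Type*} [Fintype ι] (Gβ : ι → ι → Prop) (w : ι → ι → ℝ) :
    Matrix ι ι ℝ :=
  Matrix.of fun i j =>
    if i = j then 1 - ∑ k ∈ Finset.univ.filter (fun k => k ≠ i ∧ Gβ i k), w i k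
    else if Gβ i j then w i j else 0

open Classical in
/-- The measurement matrices: row `r` of `H_i` has its only nonzero entry `h i r` at the state
`s i r`. -/
noncomputable def measurementMatrix {ι X : Type*} {p : ι → ℕ} (s : (i : ι) → Fin (p i) → X)
    (h : (i : ι) → Fin (p i) → ℝ) (i : ι) : Matrix (Fin (p i)) X ℝ :=
  Matrix.of fun r x => if x = s i r then h i r else 0

/-- Structural observability of the pair `(W ⊗ A, D_H)`, where `A` has the zero pattern of the
digraph `E`, `W` is stochastic with the pattern of `Gβ` (with a nonzero weight of each agent on
itself), and the measurement matrices have the pattern given by `s`: the pair is observable for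
some values of the nonzero parameters, and also for Lebesgue almost all of them. (The parameters
`a i j`, `w i j` that are not on a link do not occur in the matrices and do not affect what
"almost all" means.) -/
def IsStructurallyObservable {ι X : Type*} [Fintype ι] [DecidableEq ι] [Fintype X] [DecidableEq X]
    (E : X → X → Prop) (Gα Gβ : ι → ι → Prop) {p : ι → ℕ} (s : (i : ι) → Fin (p i) → X) : Prop :=
  (∃ (A : Matrix X X ℝ) (W : Matrix ι ι ℝ) (H : (i : ι) → Matrix (Fin (p i)) X ℝ),
      (∀ x y, A x y ≠ 0 ↔ E x y) ∧
      W ∈ rowStochastic ℝ ι ∧ (∀ i j, W i j ≠ 0 ↔ j ∈ nbhd Gβ i) ∧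
      (∀ i r x, H i r x ≠ 0 ↔ x = s i r) ∧
      IsObservable (W ⊗ₖ A) (DH Gα H)) ∧
  ∀ᵐ θ : (X → X → ℝ) × (ι → ι → ℝ) × ((i : ι) → Fin (p i) → ℝ) ∂volume,
    IsObservable (weightMatrix Gβ θ.2.1 ⊗ₖ systemMatrix E θ.1)
      (DH Gα (measurementMatrix s θ.2.2))

end CyberSocial

/-! Observability of a pair with polynomial entries is the nonvanishing of one polynomial, the
determinant of the observability Gramian. It therefore holds almost everywhere once it holds at one
parameter point, even a degenerate one with some link weights zero (`ae_isObservable`). A set of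
full measure is dense, so it also meets the open box of small positive parameters, where `W` is
stochastic with the required pattern. It remains to find one observable point.

By the eigenvector test, no complex eigenvector of `W ⊗ A` may vanish on all measured coordinates.
Two facts about `A` are needed, and both hold generically. If a set of states meets every
contraction, Hall's theorem gives a permutation following links of `E` except at these states
(`exists_perm_of_contraction`); hence `ker A` contains no nonzero vector that vanishes on the set.
If the set also meets every parent component, each state has a path to it, and `A` has no
eigenvector vanishing on it (`exists_noHidden`): `A` is built cycle by cycle, each new cycle with a
weight so large that its eigenvalues are separated from the old block.

For the network, weights between different strongly connected components are set to zero, so `W`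
splits into blocks (`exists_weights`). On one component `W` can be stochastic with simple spectrum
and eigenvectors `b k` without zero entries. Let `V` be an eigenvector for `c`, with coefficients `y
k` in the basis `b`. After moving `W` towards the identity by a generic `ε`, its eigenvalues `ν k`
are nonzero, and no nonzero product of an eigenvalue of `A` with `ν k` equals such a product with `ν
l`, `l ≠ k`. If `c ≠ 0`, only one `y k` can be nonzero and `V = b k ⊗ y k`. As `b k` has no zeros,
`y k` vanishes on everything measured in the component, which by (ii) and the second fact forces `y
k = 0`. If `c = 0`, each `V i` lies in `ker A` and vanishes on the states known to agent `i`, so it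
is zero by (i) and the first fact. -/

namespace CyberSocial

/-! ### Polynomial functions on a finite-dimensional space -/

/-- The algebra of polynomial functions on a real vector space. -/
def polyFn (V : Type*) [AddCommGroup V] [Module ℝ V] : Subalgebra ℝ (V → ℝ) :=
  Algebra.adjoin ℝ {f | ∃ φ : V →ₗ[ℝ] ℝ, f = φ}

namespace polyFn

variable {V : Type*} [AddCommGroup V] [Module ℝ V]

/-- Evaluation of polynomial functions at a point. -/
def ev (θ : V) : polyFn V →+* ℝ :=
  (Pi.evalRingHom (fun _ : V => ℝ) θ).comp (polyFn V).val.toRingHom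

/-- A linear functional as a polynomial function. -/
def lin (φ : V →ₗ[ℝ] ℝ) : polyFn V :=
  ⟨φ, Algebra.subset_adjoin ⟨φ, rfl⟩⟩

@[simp] lemma ev_lin (φ : V →ₗ[ℝ] ℝ) (θ : V) : ev θ (lin φ) = φ θ := rfl

/-- Restriction to lines reduces the null-set argument to the finiteness of the roots of a
one-variable polynomial. -/
lemma exists_polynomial_on_line {f : V → ℝ} (hf : f ∈ polyFn V) (a b : V) :
    ∃ q : Polynomial ℝ, ∀ t : ℝ, f (a + t • b) = q.eval t := by
  induction hf using Algebra.adjoin_induction with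
  | mem f hf =>
    obtain ⟨φ, rfl⟩ := hf
    refine ⟨Polynomial.C (φ a) + Polynomial.C (φ b) * Polynomial.X, fun t => ?_⟩
    simp only [map_add, map_smul, smul_eq_mul, Polynomial.eval_add, Polynomial.eval_mul,
      Polynomial.eval_C, Polynomial.eval_X]
    ring
  | algebraMap r => exact ⟨Polynomial.C r, fun t => by simp⟩
  | add f g _ _ hf hg =>
    obtain ⟨p, hp⟩ := hf
    obtain ⟨q, hq⟩ := hg
    exact ⟨p + q, fun t => by simp [hp, hq]⟩
  | mul f g _ _ hf hg =>
    obtain ⟨p, hp⟩ := hf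
    obtain ⟨q, hq⟩ := hg
    exact ⟨p * q, fun t => by simp [hp, hq]⟩

end polyFn

/-! ### Zero sets of polynomial functions -/

section Null

variable {V : Type*} [NormedAddCommGroup V] [NormedSpace ℝ V] [FiniteDimensional ℝ V]

lemma polyFn.continuous {f : V → ℝ} (hf : f ∈ polyFn V) : Continuous f := by
  induction hf using Algebra.adjoin_induction with
  | mem f hf =>
    obtain ⟨φ, rfl⟩ := hf
    exact φ.continuous_of_finiteDimensional
  | algebraMap r => exact continuous_const
  | add f g _ _ hf hg => exact hf.add hg
  | mul f g _ _ hf hg => exact hf.mul hg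

variable [MeasurableSpace V] [BorelSpace V]

/-- A polynomial function that does not vanish at some point vanishes almost nowhere. -/
lemma polyFn.ae_ne_zero (μ : Measure V) [μ.IsAddHaarMeasure] (f : polyFn V) (θ₀ : V)
    (h0 : ev θ₀ f ≠ 0) : ∀ᵐ θ ∂μ, ev θ f ≠ 0 := by
  set g : V → ℝ := f.1 with hg
  have hcont : Continuous g := polyFn.continuous f.2
  have hline : ∀ y : V, ∀ᵐ t : ℝ, g (θ₀ + t • y) ≠ 0 := by
    intro y
    obtain ⟨q, hq⟩ := polyFn.exists_polynomial_on_line f.2 θ₀ y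
    have hq0 : q ≠ 0 := by
      rintro rfl
      exact h0 (show g θ₀ = 0 by simpa using hq 0)
    have : {t : ℝ | ¬ g (θ₀ + t • y) ≠ 0} ⊆ (q.roots.toFinset : Set ℝ) := by
      intro t ht
      have : q.eval t = 0 := by rw [← hq]; simpa using ht
      simpa [hq0] using this
    exact measure_mono_null this (Finset.measure_zero _ _)
  have hopen : IsOpen {x : V | g x ≠ 0} := isOpen_ne_fun hcont continuous_const
  -- By Fubini, some `t ≠ 0` works for almost every direction `y`; the map `y ↦ θ₀ + t • y` then
  -- transports the null set back to `V`.
  have hswap : ∀ᵐ t : ℝ, ∀ᵐ y ∂μ, g (θ₀ + t • y) ≠ 0 := by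
    rw [← Measure.ae_ae_comm (μ := μ) (ν := (volume : Measure ℝ))
      (p := fun y t => g (θ₀ + t • y) ≠ 0)]
    · exact Filter.Eventually.of_forall hline
    · refine IsOpen.measurableSet (isOpen_ne_fun (hcont.comp ?_) continuous_const)
      fun_prop
  have hne : ∀ᵐ t : ℝ, t ≠ 0 := by simp [ae_iff]
  obtain ⟨t, ht, ht0⟩ := (hswap.and hne).exists
  have h1 : μ ((fun x => t • x) ⁻¹' {x | ¬ g (θ₀ + x) ≠ 0}) = 0 := ht
  rw [Measure.addHaar_preimage_smul μ ht0] at h1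
  have h2 : μ ((fun x => θ₀ + x) ⁻¹' {x | ¬ g x ≠ 0}) = 0 := by
    rcases mul_eq_zero.1 h1 with h | h
    · exfalso
      simp [ht0] at h
    · exact h
  rw [measure_preimage_add] at h2
  exact h2

end Null

/-! ### Genericity of observability -/

section Gram

variable {m q : Type*} [Fintype m] [DecidableEq m] [Fintype q]

/-- The observability Gramian. -/
def gramian {R : Type*} [CommRing R] (F : Matrix m m R) (G : Matrix q m R) : Matrix m m R :=
  ∑ k ∈ Finset.range (Fintype.card m), (G * F ^ k)ᵀ * (G * F ^ k)

lemma gramian_map {R S : Type*} [CommRing R] [CommRing S] (φ : R →+* S) (F : Matrix m m R)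
    (G : Matrix q m R) : (gramian F G).map φ = gramian (F.map φ) (G.map φ) := by
  have hpow : ∀ k, (F ^ k).map φ = (F.map φ) ^ k := fun k => by
    simpa using map_pow φ.mapMatrix F k
  unfold gramian
  have := map_sum φ.mapMatrix (fun k => (G * F ^ k)ᵀ * (G * F ^ k))
    (Finset.range (Fintype.card m))
  simp only [RingHom.mapMatrix_apply] at this
  rw [this]
  refine Finset.sum_congr rfl fun k _ => ?_
  rw [Matrix.map_mul, Matrix.transpose_map, Matrix.map_mul, hpow]

/-- Over `ℝ` the quadratic form of the Gramian is a sum of squares, so its kernel is the common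
kernel of the blocks `G F ^ k`. -/
lemma isObservable_iff_gramian (F : Matrix m m ℝ) (G : Matrix q m ℝ) :
    IsObservable F G ↔ (gramian F G).det ≠ 0 := by
  have key : ∀ v : m → ℝ, v ⬝ᵥ (gramian F G *ᵥ v) =
      ∑ k ∈ Finset.range (Fintype.card m), ((G * F ^ k) *ᵥ v) ⬝ᵥ ((G * F ^ k) *ᵥ v) := by
    intro v
    unfold gramian
    rw [Matrix.sum_mulVec, dotProduct_sum]
    refine Finset.sum_congr rfl fun k _ => ?_
    rw [← Matrix.mulVec_mulVec, Matrix.dotProduct_mulVec, Matrix.vecMul_transpose]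
  rw [Ne, ← Matrix.exists_mulVec_eq_zero_iff]
  constructor
  · rintro h ⟨v, hv, hGv⟩
    refine hv (h v fun k hk => ?_)
    have := key v
    rw [hGv, dotProduct_zero] at this
    have h0 := (Finset.sum_eq_zero_iff_of_nonneg
      (fun k _ => Finset.sum_nonneg fun i _ => mul_self_nonneg _)).1 this.symm k
      (Finset.mem_range.2 hk)
    exact dotProduct_self_eq_zero.1 h0
  · intro h v hv
    by_contra hne
    refine h ⟨v, hne, ?_⟩
    unfold gramian
    rw [Matrix.sum_mulVec]
    refine Finset.sum_eq_zero fun k hk => ?_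
    rw [← Matrix.mulVec_mulVec, hv k (Finset.mem_range.1 hk), Matrix.mulVec_zero]

/-- Observability of a pair with polynomial entries is a generic property. -/
lemma ae_isObservable {V : Type*} [NormedAddCommGroup V] [NormedSpace ℝ V]
    [FiniteDimensional ℝ V] [MeasurableSpace V] [BorelSpace V] (μ : Measure V)
    [μ.IsAddHaarMeasure] (F : Matrix m m (polyFn V)) (G : Matrix q m (polyFn V)) (θ₀ : V)
    (h : IsObservable (F.map (polyFn.ev θ₀)) (G.map (polyFn.ev θ₀))) :
    ∀ᵐ θ ∂μ, IsObservable (F.map (polyFn.ev θ)) (G.map (polyFn.ev θ)) := by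
  have hdet : ∀ θ, IsObservable (F.map (polyFn.ev θ)) (G.map (polyFn.ev θ)) ↔
      polyFn.ev θ (gramian F G).det ≠ 0 := fun θ => by
    rw [isObservable_iff_gramian, ← gramian_map, RingHom.map_det]
    rfl
  simp only [hdet] at h ⊢
  exact polyFn.ae_ne_zero μ _ θ₀ h

end Gram

/-! ### The eigenvector test -/

/-- A vector all of whose iterates lie in a subspace without eigenvectors is zero. -/
lemma eq_zero_of_forall_pow_mem {V : Type*} [AddCommGroup V] [Module ℂ V] [FiniteDimensional ℂ V]
    (f : Module.End ℂ V) (S : Submodule ℂ V)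
    (h : ∀ (c : ℂ) (v : V), f v = c • v → v ∈ S → v = 0) (v : V) (hv : ∀ k : ℕ, (f ^ k) v ∈ S) :
    v = 0 := by
  -- `U` is `f`-invariant and contained in `S`; if nonzero, it contains an eigenvector because `ℂ`
  -- is algebraically closed.
  set U : Submodule ℂ V := ⨅ k : ℕ, S.comap (f ^ k) with hU
  have memU : ∀ x, x ∈ U ↔ ∀ k : ℕ, (f ^ k) x ∈ S := fun x => by simp [hU, Submodule.mem_iInf]
  have hinv : ∀ x ∈ U, f x ∈ U := fun x hx => (memU _).2 fun k => by
    have := (memU x).1 hx (k + 1)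
    rwa [pow_succ] at this
  by_contra hne
  have : Nontrivial U := ⟨⟨⟨v, (memU v).2 hv⟩, 0, fun hh => hne (congrArg Subtype.val hh)⟩⟩
  obtain ⟨c, hc⟩ := Module.End.exists_eigenvalue (f.restrict hinv)
  obtain ⟨x, hx⟩ := hc.exists_hasEigenvector
  have h1 : f x.1 = c • x.1 := congrArg Subtype.val hx.apply_eq_smul
  have h2 : x.1 ∈ S := by simpa using (memU x.1).1 x.2 0
  exact hx.2 (Subtype.ext (h c x.1 h1 h2))

/-- The complexification of a real matrix. -/
noncomputable abbrev cplx {m n : Type*} (A : Matrix m n ℝ) : Matrix m n ℂ :=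
  A.map Complex.ofRealHom

/-- No complex eigenvector of the matrix vanishes on `Y`. -/
def NoHidden {m : Type*} [Fintype m] (F : Matrix m m ℝ) (Y : Set m) : Prop :=
  ∀ (c : ℂ) (z : m → ℂ), cplx F *ᵥ z = c • z → (∀ y ∈ Y, z y = 0) → z = 0

open Classical in
/-- The diagonal indicator matrix of a set of states. -/
noncomputable def indicatorMatrix {m : Type*} [DecidableEq m] (Y : Set m) (R : Type*)
    [Zero R] [One R] : Matrix m m R :=
  Matrix.diagonal fun y => if y ∈ Y then 1 else 0

lemma indicatorMatrix_map {m R S : Type*} [DecidableEq m] [Semiring R] [Semiring S]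
    (Y : Set m) (φ : R →+* S) :
    (indicatorMatrix Y R).map φ = indicatorMatrix Y S := by
  unfold indicatorMatrix
  rw [Matrix.diagonal_map (map_zero _)]
  congr 1
  ext y
  split_ifs <;> simp

section

variable {m q : Type*} [Fintype m]

lemma cplx_mulVec_ofReal (F : Matrix q m ℝ) (v : m → ℝ) :
    cplx F *ᵥ (fun x => (v x : ℂ)) = fun x => ((F *ᵥ v) x : ℂ) := by
  ext x
  simp [Matrix.mulVec, dotProduct]

lemma mulVec_re (F : Matrix q m ℝ) (z : m → ℂ) :
    F *ᵥ (fun x => (z x).re) = fun x => ((cplx F *ᵥ z) x).re := by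
  ext x
  simp [Matrix.mulVec, dotProduct]

lemma mulVec_im (F : Matrix q m ℝ) (z : m → ℂ) :
    F *ᵥ (fun x => (z x).im) = fun x => ((cplx F *ᵥ z) x).im := by
  ext x
  simp [Matrix.mulVec, dotProduct]

lemma noHidden_mono {F : Matrix m m ℝ} {Y Y' : Set m} (hY : Y ⊆ Y') (h : NoHidden F Y) :
    NoHidden F Y' := fun c z hz hY' => h c z hz fun y hy => hY' y (hY hy)

variable [DecidableEq m]

lemma cplx_pow (F : Matrix m m ℝ) (k : ℕ) : cplx (F ^ k) = cplx F ^ k := by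
  simpa using map_pow Complex.ofRealHom.mapMatrix F k

lemma pow_mulVec_of_eigen {R : Type*} [CommRing R] (F : Matrix m m R) (c : R) (z : m → R)
    (h : F *ᵥ z = c • z) (k : ℕ) : (F ^ k) *ᵥ z = c ^ k • z := by
  induction k with
  | zero => simp
  | succ k ih => rw [pow_succ, ← Matrix.mulVec_mulVec, h, Matrix.mulVec_smul, ih, smul_smul, pow_succ']

/-- By Cayley–Hamilton every power of `F` is a combination of the powers below `card m`. -/
lemma pow_mulVec_apply_eq_zero (F : Matrix m m ℝ) (v : m → ℝ) (y : m)
    (h : ∀ k < Fintype.card m, ((F ^ k) *ᵥ v) y = 0) (k : ℕ) : ((F ^ k) *ᵥ v) y = 0 := by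
  have : Nonempty m := ⟨y⟩
  rw [Matrix.pow_eq_aeval_mod_charpoly]
  have hdeg : (Polynomial.X ^ k %ₘ F.charpoly).natDegree < Fintype.card m := by
    have := Polynomial.natDegree_modByMonic_lt (Polynomial.X ^ k) F.charpoly_monic ?_
    · rwa [Matrix.charpoly_natDegree_eq_dim] at this
    · intro h1
      have h2 := F.charpoly_natDegree_eq_dim
      rw [h1] at h2
      exact Fintype.card_ne_zero (α := m) (by simpa using h2.symm)
  rw [Polynomial.aeval_eq_sum_range' hdeg, Matrix.sum_mulVec, Finset.sum_apply]
  refine Finset.sum_eq_zero fun j hj => ?_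
  rw [Matrix.smul_mulVec, Pi.smul_apply, h j (Finset.mem_range.1 hj), smul_zero]

/-- The eigenvector test of Popov, Belevitch and Hautus. -/
lemma isObservable_iff_noHidden [Fintype q] (F : Matrix m m ℝ) (G : Matrix q m ℝ) (Y : Set m)
    (hG : ∀ v, G *ᵥ v = 0 ↔ ∀ y ∈ Y, v y = 0) : IsObservable F G ↔ NoHidden F Y := by
  have hobs : IsObservable F G ↔
      ∀ v : m → ℝ, (∀ k < Fintype.card m, ∀ y ∈ Y, ((F ^ k) *ᵥ v) y = 0) → v = 0 := by
    unfold IsObservable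
    simp only [← Matrix.mulVec_mulVec, hG]
  rw [hobs]
  constructor
  · intro h c z hz hzY
    have hpow : ∀ k, ∀ y ∈ Y, ((cplx (F ^ k)) *ᵥ z) y = 0 := fun k y hy => by
      rw [cplx_pow, pow_mulVec_of_eigen _ c z hz, Pi.smul_apply, hzY y hy, smul_zero]
    -- The real and imaginary parts of a hidden complex eigenvector are real vectors all of whose
    -- iterates vanish on `Y`.
    have hre := h (fun x => (z x).re) fun k _ y hy => by
      rw [mulVec_re]; simp only [hpow k y hy, Complex.zero_re]
    have him := h (fun x => (z x).im) fun k _ y hy => by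
      rw [mulVec_im]; simp only [hpow k y hy, Complex.zero_im]
    ext x
    exact Complex.ext (congrFun hre x) (congrFun him x)
  · intro h v hv
    let S : Submodule ℂ (m → ℂ) :=
      { carrier := {z | ∀ y ∈ Y, z y = 0}
        add_mem' := fun ha hb y hy => by simp [ha y hy, hb y hy]
        zero_mem' := fun y _ => rfl
        smul_mem' := fun c z hz y hy => by simp [hz y hy] }
    have h0 := eq_zero_of_forall_pow_mem (Matrix.toLinAlgEquiv' (cplx F)) S
      (fun c z hz hzS => h c z hz hzS) (fun x => (v x : ℂ)) fun k => by
        rw [← map_pow, ← cplx_pow]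
        intro y hy
        change (cplx (F ^ k) *ᵥ fun x => (v x : ℂ)) y = 0
        rw [cplx_mulVec_ofReal]
        simp only [pow_mulVec_apply_eq_zero F v y (fun k hk => hv k hk y hy) k, Complex.ofReal_zero]
    ext x
    exact Complex.ofReal_eq_zero.1 (congrFun h0 x)

lemma indicatorMatrix_mulVec_eq_zero (Y : Set m) (v : m → ℝ) :
    indicatorMatrix Y ℝ *ᵥ v = 0 ↔ ∀ y ∈ Y, v y = 0 := by
  constructor
  · intro h y hy
    have := congrFun h y
    simpa [indicatorMatrix, Matrix.mulVec_diagonal, hy] using this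
  · intro h
    ext y
    by_cases hy : y ∈ Y <;> simp [indicatorMatrix, Matrix.mulVec_diagonal, hy]
    exact h y hy

/-- Absence of hidden eigenvectors is a generic property. -/
lemma ae_noHidden {V : Type*} [NormedAddCommGroup V] [NormedSpace ℝ V]
    [FiniteDimensional ℝ V] [MeasurableSpace V] [BorelSpace V] (μ : Measure V)
    [μ.IsAddHaarMeasure] (F : Matrix m m (polyFn V)) (Y : Set m) (θ₀ : V)
    (h : NoHidden (F.map (polyFn.ev θ₀)) Y) :
    ∀ᵐ θ ∂μ, NoHidden (F.map (polyFn.ev θ)) Y := by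
  have key : ∀ θ, IsObservable (F.map (polyFn.ev θ))
      ((indicatorMatrix Y (polyFn V)).map (polyFn.ev θ)) ↔ NoHidden (F.map (polyFn.ev θ)) Y := by
    intro θ
    refine isObservable_iff_noHidden _ _ Y fun v => ?_
    rw [← indicatorMatrix_mulVec_eq_zero]
    rw [indicatorMatrix_map]
  simp only [← key] at h ⊢
  exact ae_isObservable μ F _ θ₀ h

end

/-! ### Contractions and parent components -/

section

variable {X : Type*} [Fintype X]

/-- A set of states in a finite digraph that meets every parent component can be reached from
every state. -/
lemma exists_hasPath_of_parentSCC (E : X → X → Prop) (Y : Set X)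
    (hY : ∀ S, IsParentSCC E S → ∃ y ∈ Y, y ∈ S) (x : X) : ∃ y ∈ Y, HasPath E x y := by
  -- A reachable state from which the fewest states can be reached lies in a component without
  -- outgoing links.
  obtain ⟨z, hxz, hmin⟩ := Set.exists_min_image {z | HasPath E x z}
    (fun z => Set.ncard {w | HasPath E z w}) (Set.toFinite _) ⟨x, Relation.ReflTransGen.refl⟩
  obtain ⟨y, hyY, hzy, -⟩ := hY {w | HasPath E z w ∧ HasPath E w z} ⟨⟨z, rfl⟩, by
    rintro y ⟨hzy, hyz⟩ u huy
    have hzu : HasPath E z u := Relation.ReflTransGen.tail hzy huy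
    refine ⟨hzu, ?_⟩
    have hsub : {w | HasPath E u w} ⊆ {w | HasPath E z w} := fun w hw =>
      Relation.ReflTransGen.trans hzu hw
    have heq := Set.eq_of_subset_of_ncard_le hsub
      (hmin u (Relation.ReflTransGen.trans hxz hzu)) (Set.toFinite _)
    have : z ∈ {w | HasPath E z w} := Relation.ReflTransGen.refl
    rw [← heq] at this
    exact this⟩
  exact ⟨y, hyY, Relation.ReflTransGen.trans hxz hzy⟩

open Classical in
/-- If a set of states meets every contraction, then the digraph in which the states of this set
send links to all states has a spanning family of disjoint cycles. -/
lemma exists_perm_of_contraction (E : X → X → Prop) (Y : Set X)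
    (hY : ∀ C, IsContraction E C → ∃ y ∈ Y, y ∈ C) :
    ∃ π : Equiv.Perm X, ∀ j, j ∈ Y ∨ E (π j) j := by
  suffices h : ∃ f : X → X, Function.Injective f ∧ ∀ j, j ∈ Y ∨ E (f j) j by
    obtain ⟨f, hf, h⟩ := h
    exact ⟨Equiv.ofBijective f (Finite.injective_iff_bijective.1 hf), h⟩
  refine (Fintype.all_card_le_filter_rel_iff_exists_injective
    (fun j i => j ∈ Y ∨ E i j)).1 ?_
  by_contra! hviol
  -- A smallest violator `J` of Hall's condition avoids `Y`, since a state of `Y` is joined to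
  -- everything. The aim is a contraction inside `J`.
  obtain ⟨J, hJ, hmin⟩ := Finset.exists_min_image
    (Finset.univ.filter fun J : Finset X =>
      (Finset.univ.filter fun i => ∃ j ∈ J, j ∈ Y ∨ E i j).card < J.card) Finset.card
    (by obtain ⟨J, hJ⟩ := hviol; exact ⟨J, by simpa using hJ⟩)
  replace hJ := (Finset.mem_filter.1 hJ).2
  have hJY : ∀ j ∈ J, j ∉ Y := by
    intro j hj hjY
    have : (Finset.univ.filter fun i : X => ∃ j ∈ J, j ∈ Y ∨ E i j) = Finset.univ :=
      Finset.filter_true_of_mem fun i _ => ⟨j, hj, Or.inl hjY⟩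
    rw [this] at hJ
    exact absurd (Finset.card_le_univ J) (not_le.2 hJ)
  set N : Finset X := Finset.univ.filter fun i => ∃ j ∈ J, E i j with hN
  have hNJ : N.card < J.card := by
    refine lt_of_le_of_lt (Finset.card_le_card fun i hi => ?_) hJ
    obtain ⟨j, hj, hE⟩ := (Finset.mem_filter.1 hi).2
    exact Finset.mem_filter.2 ⟨Finset.mem_univ _, j, hj, Or.inr hE⟩
  have memN : ∀ i, i ∈ N ↔ ∃ j ∈ J, E i j := fun i => by simp [hN]
  -- By minimality Hall's condition holds on `J` without `v`. As `|N| ≤ |J| - 1`, the resulting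
  -- injection into `N` is onto `N`.
  obtain ⟨v, hv⟩ : J.Nonempty := Finset.card_pos.1 (lt_of_le_of_lt (Nat.zero_le _) hNJ)
  obtain ⟨g, hginj, hg⟩ : ∃ g : {x // x ∈ J.erase v} → X, Function.Injective g ∧
      ∀ j, E (g j) j.1 := by
    refine (Fintype.all_card_le_filter_rel_iff_exists_injective
      (fun (j : {x // x ∈ J.erase v}) i => E i j.1)).1 fun A => ?_
    by_contra! hA
    have hAsub : A.map (Function.Embedding.subtype _) ⊆ J.erase v := fun x hx => by
      obtain ⟨a, -, rfl⟩ := Finset.mem_map.1 hx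
      exact a.2
    have hlt : (A.map (Function.Embedding.subtype _)).card < J.card :=
      lt_of_le_of_lt (Finset.card_le_card hAsub) (Finset.card_erase_lt_of_mem hv)
    refine absurd (hmin (A.map (Function.Embedding.subtype _)) ?_) (not_le.2 hlt)
    refine Finset.mem_filter.2 ⟨Finset.mem_univ _, ?_⟩
    rw [Finset.card_map]
    refine lt_of_le_of_lt (Finset.card_le_card fun i hi => ?_) hA
    obtain ⟨j, hj, h⟩ := (Finset.mem_filter.1 hi).2
    obtain ⟨a, ha, rfl⟩ := Finset.mem_map.1 hj
    refine Finset.mem_filter.2 ⟨Finset.mem_univ _, a, ha, h.resolve_left ?_⟩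
    exact hJY _ (Finset.mem_of_mem_erase a.2)
  have hgN : ∀ j, g j ∈ N := fun j => (memN _).2 ⟨j.1, Finset.mem_of_mem_erase j.2, hg j⟩
  set P : Finset (X × X) := Finset.univ.image fun j => (g j, j.1) with hP
  have memP : ∀ e, e ∈ P ↔ ∃ j, (g j, j.1) = e := fun e => by simp [hP]
  have hPcard : N.card ≤ P.card := by
    rw [hP, Finset.card_image_of_injective _ fun a b h => hginj (Prod.ext_iff.1 h).1,
      Finset.card_univ, Fintype.card_coe, Finset.card_erase_of_mem hv]
    omega
  obtain ⟨M₀, hM₀, hmax⟩ := Finset.exists_max_image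
    (Finset.univ.filter fun M : Finset (X × X) => IsMatching E M) Finset.card
    ⟨∅, by simp [IsMatching]⟩
  replace hM₀ := (Finset.mem_filter.1 hM₀).2
  -- In a maximum matching, the at most `|N|` edges ending in `N` are exchanged for `P`. The size
  -- does not drop, and `v` is left unmatched.
  set Q : Finset (X × X) := M₀.filter fun e => e.1 ∉ N with hQ
  have memQ : ∀ e, e ∈ Q ↔ e ∈ M₀ ∧ e.1 ∉ N := fun e => by simp [hQ]
  have hQP : ∀ e ∈ Q, ∀ f ∈ P, ¬ (e.1 = f.1 ∨ e.2 = f.2) := by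
    intro e he f hf h
    obtain ⟨j, rfl⟩ := (memP f).1 hf
    obtain ⟨heM, heN⟩ := (memQ e).1 he
    rcases h with h | h
    · exact heN (h ▸ hgN j)
    · refine heN ((memN _).2 ⟨j.1, Finset.mem_of_mem_erase j.2, ?_⟩)
      have := hM₀.1 e heM
      rwa [h] at this
  have hmatch : IsMatching E (Q ∪ P) := by
    constructor
    · intro e he
      rcases Finset.mem_union.1 he with he | he
      · exact hM₀.1 e ((memQ e).1 he).1
      · obtain ⟨j, rfl⟩ := (memP e).1 he
        exact hg j
    · intro e he f hf h
      rcases Finset.mem_union.1 he with he | he <;> rcases Finset.mem_union.1 hf with hf | hf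
      · exact hM₀.2 e ((memQ e).1 he).1 f ((memQ f).1 hf).1 h
      · exact absurd h (hQP e he f hf)
      · exact absurd (h.imp Eq.symm Eq.symm) (hQP f hf e he)
      · obtain ⟨j, rfl⟩ := (memP e).1 he
        obtain ⟨k, rfl⟩ := (memP f).1 hf
        rcases h with h | h
        · rw [hginj h]
        · rw [Subtype.ext h]
  have hcard : M₀.card ≤ (Q ∪ P).card := by
    have hdisj : Disjoint Q P := Finset.disjoint_left.2 fun e he hf =>
      hQP e he e hf (Or.inl rfl)
    rw [Finset.card_union_of_disjoint hdisj]
    have h0 := Finset.card_filter_add_card_filter_not (s := M₀) (fun e => e.1 ∈ N)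
    have h2 : (M₀.filter fun e => ¬ e.1 ∈ N).card = Q.card := by rw [hQ]
    have h1 : (M₀.filter fun e => e.1 ∈ N).card ≤ N.card :=
      Finset.card_le_card_of_injOn Prod.fst (fun e he => (Finset.mem_filter.1 he).2)
        fun e he f hf h => hM₀.2 e (Finset.mem_filter.1 he).1 f (Finset.mem_filter.1 hf).1
          (Or.inl h)
    omega
  have hmaxM : IsMaximumMatching E (Q ∪ P) := ⟨hmatch, fun M' hM' =>
    (hmax M' (Finset.mem_filter.2 ⟨Finset.mem_univ _, hM'⟩)).trans hcard⟩
  have hunm : IsUnmatched (Q ∪ P) v := by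
    intro e he hev
    rcases Finset.mem_union.1 he with he | he
    · obtain ⟨heM, heN⟩ := (memQ e).1 he
      exact heN ((memN _).2 ⟨v, hv, hev ▸ hM₀.1 e heM⟩)
    · obtain ⟨j, rfl⟩ := (memP e).1 he
      exact (Finset.mem_erase.1 j.2).1 hev
  -- Links lead from `J` into `N`, and the matching edges at `N` all belong to `P`, so they lead
  -- back into `J`.
  have hreach : ∀ u, Relation.ReflTransGen (AuxEdge E (Q ∪ P)) (Sum.inl v) u →
      Sum.elim (fun x => x ∈ J) (fun i => i ∈ N) u := by
    intro u hu
    induction hu with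
    | refl => exact hv
    | tail _ hstep ih =>
      cases hstep with
      | keep h hM => exact (memN _).2 ⟨_, ih, h⟩
      | reverse hM =>
        rcases Finset.mem_union.1 hM with h | h
        · exact absurd ih ((memQ _).1 h).2
        · obtain ⟨j, hj⟩ := (memP _).1 h
          have h2 : j.1 = _ := (Prod.ext_iff.1 hj).2
          have h3 : j.1 ∈ J := Finset.mem_of_mem_erase j.2
          rw [h2] at h3
          exact h3
  obtain ⟨y, hyY, hyC⟩ := hY _ ⟨Q ∪ P, hmaxM, v, hunm, rfl⟩
  exact hJY y (hreach _ hyC) hyY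

end

/-! ### Structural observability of a single system -/

section

variable {X : Type*} [Fintype X] [DecidableEq X]

/-- For large frequencies, the response of an observable system to an input at a single state
does not vanish on the outputs. -/
lemma exists_transfer_bound (A : Matrix X X ℂ) (Z Y : Set X) (i : X) (hi : i ∈ Z)
    (hA : ∀ a b, A a b ≠ 0 → a ∈ Z)
    (hno : ∀ (c : ℂ) (z : X → ℂ), A *ᵥ z = c • z → (∀ y ∈ Y, z y = 0) → (∀ x, x ∉ Z → z x = 0) →
      z = 0) :
    ∃ r : ℝ, 0 ≤ r ∧ ∀ (c : ℂ) (z : X → ℂ) (s : ℂ), r < ‖c‖ →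
      c • z = A *ᵥ z + s • Pi.single i 1 → (∀ y ∈ Y, z y = 0) → s = 0 := by
  by_contra! hcon
  set e : X → ℂ := Pi.single i 1 with he
  have hscaled : ∀ n : ℕ, ∃ (c : ℂ) (z : X → ℂ), (n : ℝ) < ‖c‖ ∧ c • z = A *ᵥ z + e ∧
      ∀ y ∈ Y, z y = 0 := by
    intro n
    obtain ⟨c, z, s, hc, heq, hz, hs⟩ := hcon n n.cast_nonneg
    refine ⟨c, s⁻¹ • z, hc, ?_, fun y hy => by simp [hz y hy]⟩
    rw [smul_comm, heq, smul_add, smul_smul, inv_mul_cancel₀ hs, one_smul, Matrix.mulVec_smul]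
  choose c z hc heq hz using hscaled
  set L : (X → ℂ) →L[ℂ] (X → ℂ) := LinearMap.toContinuousLinearMap (Matrix.mulVecLin A) with hL
  have hLapp : ∀ v, L v = A *ᵥ v := fun v => rfl
  have hbound : ∀ n : ℕ, ((n : ℝ) - ‖L‖) * ‖z n‖ ≤ ‖e‖ := by
    intro n
    have h1 : ‖c n‖ * ‖z n‖ ≤ ‖L‖ * ‖z n‖ + ‖e‖ := by
      rw [← norm_smul, heq]
      refine (norm_add_le _ _).trans (add_le_add ?_ le_rfl)
      rw [← hLapp]
      exact L.le_opNorm _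
    have h2 : (n : ℝ) * ‖z n‖ ≤ ‖c n‖ * ‖z n‖ :=
      mul_le_mul_of_nonneg_right (hc n).le (norm_nonneg _)
    linarith
  -- The resolvent decays at infinity, so a bounded input at frequencies `c n → ∞` forces the
  -- responses to zero.
  have hlim : Filter.Tendsto z Filter.atTop (nhds 0) := by
    rw [tendsto_zero_iff_norm_tendsto_zero]
    have hden : Filter.Tendsto (fun n : ℕ => (n : ℝ) - ‖L‖) Filter.atTop Filter.atTop :=
      Filter.tendsto_atTop_add_const_right _ _ tendsto_natCast_atTop_atTop
    refine squeeze_zero' (Filter.Eventually.of_forall fun n => norm_nonneg _) ?_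
      (hden.const_div_atTop ‖e‖)
    filter_upwards [hden.eventually_gt_atTop 0] with n hn
    rw [le_div_iff₀ hn, mul_comm]
    exact hbound n
  -- Applying `A ^ k` to the equation gives `A ^ k e = -A ^ (k + 1) z n` on `Y`. The left side does
  -- not depend on `n` and the right side tends to zero, so both vanish and the induction advances.
  have hzero : ∀ k : ℕ, (∀ n, ∀ y ∈ Y, ((A ^ k) *ᵥ z n) y = 0) ∧
      ∀ y ∈ Y, ((A ^ k) *ᵥ e) y = 0 := by
    have hstep : ∀ k : ℕ, (∀ n, ∀ y ∈ Y, ((A ^ k) *ᵥ z n) y = 0) →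
        ∀ n, ∀ y ∈ Y, ((A ^ k) *ᵥ e) y = -((A ^ (k + 1)) *ᵥ z n) y := by
      intro k hk n y hy
      have := congrFun (congrArg (fun v => (A ^ k) *ᵥ v) (heq n)) y
      simp only [Matrix.mulVec_smul, Matrix.mulVec_add, Pi.smul_apply, Pi.add_apply, hk n y hy,
        smul_zero, Matrix.mulVec_mulVec, ← pow_succ] at this
      exact eq_neg_of_add_eq_zero_right this.symm
    have hlast : ∀ k : ℕ, (∀ n, ∀ y ∈ Y, ((A ^ k) *ᵥ z n) y = 0) →
        ∀ y ∈ Y, ((A ^ k) *ᵥ e) y = 0 := by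
      intro k hk y hy
      have hcont : Continuous fun v : X → ℂ => -((A ^ (k + 1)) *ᵥ v) y := by
        refine Continuous.neg ?_
        exact (continuous_apply y).comp (Matrix.mulVecLin (A ^ (k + 1))).continuous_of_finiteDimensional
      have h1 := (hcont.tendsto 0).comp hlim
      have h2 : (fun v : X → ℂ => -((A ^ (k + 1)) *ᵥ v) y) ∘ z = fun _ => ((A ^ k) *ᵥ e) y := by
        ext n
        exact (hstep k hk n y hy).symm
      rw [h2] at h1
      simpa using tendsto_nhds_unique tendsto_const_nhds h1
    intro k
    induction k with
    | zero =>
      have h0 : ∀ n, ∀ y ∈ Y, ((A ^ 0) *ᵥ z n) y = 0 := fun n y hy => by simpa using hz n y hy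
      exact ⟨h0, hlast 0 h0⟩
    | succ k ih =>
      have h0 : ∀ n, ∀ y ∈ Y, ((A ^ (k + 1)) *ᵥ z n) y = 0 := fun n y hy => by
        have := hstep k ih.1 n y hy
        rw [ih.2 y hy] at this
        exact neg_eq_zero.1 this.symm
      exact ⟨h0, hlast _ h0⟩
  have hsupp : ∀ k : ℕ, ∀ x, x ∉ Z → ((A ^ k) *ᵥ e) x = 0 := by
    intro k x hx
    cases k with
    | zero =>
      rw [pow_zero, Matrix.one_mulVec]
      have hxi : x ≠ i := fun h => hx (by rw [h]; exact hi)
      exact Pi.single_eq_of_ne hxi _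
    | succ k =>
      rw [pow_succ', ← Matrix.mulVec_mulVec]
      refine Finset.sum_eq_zero fun b _ => ?_
      have : A x b = 0 := by
        by_contra h
        exact hx (hA x b h)
      simp only [this, zero_mul]
  let S : Submodule ℂ (X → ℂ) :=
    { carrier := {v | (∀ y ∈ Y, v y = 0) ∧ ∀ x, x ∉ Z → v x = 0}
      add_mem' := fun ha hb => ⟨fun y hy => by simp [ha.1 y hy, hb.1 y hy],
        fun y hy => by simp [ha.2 y hy, hb.2 y hy]⟩
      zero_mem' := ⟨fun y _ => rfl, fun y _ => rfl⟩
      smul_mem' := fun c v hv => ⟨fun y hy => by simp [hv.1 y hy],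
        fun y hy => by simp [hv.2 y hy]⟩ }
  have h0 := eq_zero_of_forall_pow_mem (Matrix.toLinAlgEquiv' A) S
    (fun c v hv hvS => hno c v hv hvS.1 hvS.2) e fun k => by
      rw [← map_pow]
      exact ⟨(hzero k).2, hsupp k⟩
  have := congrFun h0 i
  simp [he] at this

/-- There is a matrix with the pattern `R` (where the columns in `Y` are arbitrary) on the states
of `Z`, none of whose eigenvectors vanishes on `Y`. -/
def HasObservableBlock (R : X → X → Prop) (Y Z : Set X) : Prop :=
  ∃ A : Matrix X X ℝ, (∀ a b, A a b ≠ 0 → a ∈ Z ∧ b ∈ Z ∧ (b ∈ Y ∨ R a b)) ∧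
    ∀ (c : ℂ) (z : X → ℂ), cplx A *ᵥ z = c • z → (∀ y ∈ Y, z y = 0) → (∀ x, x ∉ Z → z x = 0) →
      z = 0

open Classical in
/-- An observable block is extended by a cycle that meets the outputs or has a link into the
block. -/
lemma HasObservableBlock.extend {R : X → X → Prop} {Y Z : Set X} (h : HasObservableBlock R Y Z)
    (π : Equiv.Perm X) (hπ : ∀ j, j ∈ Y ∨ R (π j) j) (hZ : ∀ x, π x ∈ Z ↔ x ∈ Z) {j : X}
    (hj : j ∉ Z) (hlink : j ∈ Y ∨ ∃ i ∈ Z, R i j) :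
    HasObservableBlock R Y (Z ∪ {k | π.SameCycle j k}) := by
  obtain ⟨A, hA, hno⟩ := h
  set K : Set X := {k | π.SameCycle j k} with hK
  have hjK : j ∈ K := Equiv.Perm.SameCycle.refl _ _
  have hπK : ∀ k, π k ∈ K ↔ k ∈ K := fun k => Equiv.Perm.sameCycle_apply_right
  have hpowZ : ∀ (n : ℕ) x, (π ^ n) x ∈ Z ↔ x ∈ Z := by
    intro n
    induction n with
    | zero => simp
    | succ n ih => intro x; rw [pow_succ', Equiv.Perm.mul_apply, hZ, ih]
  have hKZ : ∀ k ∈ K, k ∉ Z := by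
    intro k hk hkZ
    obtain ⟨n, -, hn⟩ := Equiv.Perm.SameCycle.exists_pow_eq' (show π.SameCycle j k from hk)
    rw [← hn, hpowZ] at hkZ
    exact hj hkZ
  have hAcol : ∀ (z : X → ℂ) x, x ∉ Z → (cplx A *ᵥ z) x = 0 := by
    intro z x hx
    refine Finset.sum_eq_zero fun b _ => ?_
    have : A x b = 0 := by
      by_contra hne
      exact hx (hA x b hne).1
    simp [this]
  -- Both cases in one form: with `j ∈ Y` no link is needed, so `τ = 0` and `i` is a dummy;
  -- otherwise `τ = 1` on a link from `j` into the block.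
  obtain ⟨i, τ, hi, hr⟩ : ∃ (i : X) (τ : ℝ), (τ ≠ 0 → i ∈ Z ∧ R i j) ∧
      ∃ r : ℝ, 0 ≤ r ∧ ∀ (c : ℂ) (z z₁ : X → ℂ), r < ‖c‖ →
        c • z₁ = cplx A *ᵥ z₁ + ((τ : ℂ) * z j) • Pi.single i 1 → (∀ y ∈ Y, z y = 0) →
        (∀ y ∈ Y, z₁ y = 0) → z j = 0 := by
    rcases hlink with hjY | ⟨i, hi, hR⟩
    · exact ⟨j, 0, fun h => absurd rfl h, 0, le_rfl, fun c z z₁ _ _ hz _ => hz j hjY⟩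
    · obtain ⟨r, hr0, hr⟩ := exists_transfer_bound (cplx A) Z Y i hi
        (fun a b hab => (hA a b fun h0 => hab (by simp [h0])).1) hno
      exact ⟨i, 1, fun _ => ⟨hi, hR⟩, r, hr0, fun c z z₁ hc heq _ hz₁ => by
        simpa using hr c z₁ _ hc heq hz₁⟩
  obtain ⟨r, hr0, hr⟩ := hr
  -- The cycle weight exceeds the transfer threshold `r` of the block.
  set w : ℝ := r + 1 with hw
  have hw0 : 0 < w := by linarith
  set P : Matrix X X ℝ := Matrix.of fun a b => if b ∈ K ∧ a = π b then w else 0 with hP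
  set T : Matrix X X ℝ := Matrix.of fun a b => if b = j ∧ a = i then τ else 0 with hT
  have hPz : ∀ (z : X → ℂ) b, (cplx P *ᵥ z) (π b) = if b ∈ K then (w : ℂ) * z b else 0 := by
    intro z b
    rw [Matrix.mulVec, dotProduct, Finset.sum_eq_single b]
    · by_cases hb : b ∈ K <;> simp [hP, hb]
    · intro b' _ hne
      simp [hP, hne.symm]
    · simp
  have hTz : ∀ (z : X → ℂ), cplx T *ᵥ z = ((τ : ℂ) * z j) • Pi.single i 1 := by
    intro z
    ext a
    rw [Matrix.mulVec, dotProduct, Finset.sum_eq_single j]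
    · by_cases ha : a = i
      · subst ha; simp [hT]
      · simp [hT, ha]
    · intro b' _ hne
      simp [hT, hne]
    · simp
  refine ⟨A + P + T, ?_, ?_⟩
  · intro a b hab
    by_cases h1 : A a b = 0
    · by_cases h2 : P a b = 0
      · have h3 : T a b ≠ 0 := by simpa [h1, h2] using hab
        have h4 : b = j ∧ a = i ∧ τ ≠ 0 := by simpa [hT] using h3
        obtain ⟨rfl, rfl, h5⟩ := h4
        exact ⟨Or.inl (hi h5).1, Or.inr hjK, Or.inr (hi h5).2⟩
      · have h4 : b ∈ K ∧ a = π b ∧ w ≠ 0 := by simpa [hP] using h2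
        obtain ⟨hb, rfl, -⟩ := h4
        exact ⟨Or.inr ((hπK b).2 hb), Or.inr hb, hπ b⟩
    · obtain ⟨ha, hb, hR⟩ := hA a b h1
      exact ⟨Or.inl ha, Or.inl hb, hR⟩
  · intro c z hz hzY hzZ
    have hz' : ∀ a, (cplx A *ᵥ z) a + (cplx P *ᵥ z) a + (cplx T *ᵥ z) a = c * z a := by
      intro a
      have := congrFun hz a
      rwa [cplx, Matrix.map_add _ (map_add _), Matrix.map_add _ (map_add _), Matrix.add_mulVec,
        Matrix.add_mulVec] at this
    have hTz0 : ∀ a, a ∉ Z → (cplx T *ᵥ z) a = 0 := by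
      intro a ha
      rw [hTz]
      by_cases hτ : τ = 0
      · simp [hτ]
      · have : a ≠ i := fun h => ha (h ▸ (hi hτ).1)
        simp [this]
    -- Nothing from outside feeds the cycle. Going round it gives `‖c‖ = w > r` unless `z j = 0`,
    -- and then the transfer bound excludes `z j ≠ 0`.
    have hcyc : ∀ b ∈ K, (w : ℂ) * z b = c * z (π b) := by
      intro b hb
      have hb' : π b ∉ Z := hKZ _ ((hπK b).2 hb)
      rw [← hz', hAcol _ _ hb', hTz0 _ hb', hPz, if_pos hb, zero_add, add_zero]
    have hcycpow : ∀ (n : ℕ), ∀ b ∈ K, (w : ℂ) ^ n * z b = c ^ n * z ((π ^ n) b) := by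
      intro n
      induction n with
      | zero => simp
      | succ n ih =>
        intro b hb
        rw [pow_succ, mul_assoc, hcyc b hb, mul_left_comm, ih (π b) ((hπK b).2 hb), ← mul_assoc,
          ← pow_succ', pow_succ π, Equiv.Perm.mul_apply]
    have hwC : (w : ℂ) ≠ 0 := Complex.ofReal_ne_zero.2 hw0.ne'
    have hnorm : z j ≠ 0 → ‖c‖ = w := by
      intro hzj
      have h1 := hcycpow (orderOf π) j hjK
      rw [pow_orderOf_eq_one, Equiv.Perm.one_apply] at h1
      have h2 := congrArg norm (mul_right_cancel₀ hzj h1)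
      rw [norm_pow, norm_pow, Complex.norm_real, Real.norm_of_nonneg hw0.le] at h2
      exact (pow_left_inj₀ (norm_nonneg _) hw0.le (orderOf_pos π).ne').1 h2.symm
    set z₁ : X → ℂ := fun x => if x ∈ Z then z x else 0 with hz₁
    have hAz₁ : cplx A *ᵥ z = cplx A *ᵥ z₁ := by
      ext a
      refine Finset.sum_congr rfl fun b _ => ?_
      by_cases hb : b ∈ Z
      · simp [hz₁, hb]
      · have : A a b = 0 := by
          by_contra hne
          exact hb (hA a b hne).2.1
        simp [this]
    have hblock : c • z₁ = cplx A *ᵥ z₁ + cplx T *ᵥ z := by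
      ext a
      by_cases ha : a ∈ Z
      · have hPa : (cplx P *ᵥ z) a = 0 := by
          have h1 := hPz z (π.symm a)
          rw [Equiv.apply_symm_apply] at h1
          rw [h1, if_neg]
          intro h2
          refine hKZ _ h2 ?_
          rw [← hZ, Equiv.apply_symm_apply]
          exact ha
        have h1 := hz' a
        rw [hPa, add_zero, hAz₁] at h1
        rw [Pi.add_apply, h1]
        simp [hz₁, ha]
      · rw [Pi.add_apply, hTz0 a ha, hAcol _ a ha]
        simp [hz₁, ha]
    have hz₁Y : ∀ y ∈ Y, z₁ y = 0 := fun y hy => by simp [hz₁, hzY y hy]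
    have hzj : z j = 0 := by
      by_contra hne
      refine hne (hr c z z₁ ?_ ?_ hzY hz₁Y)
      · rw [hnorm hne]; linarith
      · rw [hblock, hTz]
    have hzK : ∀ k ∈ K, z k = 0 := by
      intro k hk
      obtain ⟨n, -, hn⟩ := Equiv.Perm.SameCycle.exists_pow_eq' (show π.SameCycle j k from hk).symm
      have h1 := hcycpow n k hk
      rw [hn, hzj, mul_zero] at h1
      exact (mul_eq_zero.1 h1).resolve_left (pow_ne_zero _ hwC)
    have h₁ : z₁ = 0 := by
      refine hno c z₁ ?_ hz₁Y fun x hx => by simp [hz₁, hx]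
      rw [hblock, hTz, hzj]
      simp
    ext x
    by_cases hx : x ∈ Z
    · have := congrFun h₁ x
      simpa [hz₁, hx] using this
    · by_cases hxK : x ∈ K
      · exact hzK x hxK
      · exact hzZ x fun h => h.elim hx hxK

open Classical in
/-- A pattern with a spanning family of disjoint cycles (up to arbitrary columns in `Y`), all of
whose states have a path to `Y`, is structurally observable from `Y`. -/
lemma exists_noHidden (R : X → X → Prop) (Y : Set X) (π : Equiv.Perm X)
    (hπ : ∀ j, j ∈ Y ∨ R (π j) j) (hpath : ∀ x, ∃ y ∈ Y, HasPath R x y) :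
    ∃ A : Matrix X X ℝ, (∀ a b, A a b ≠ 0 → R a b) ∧ NoHidden A Y := by
  -- A maximal `π`-invariant observable block is everything: otherwise a path to `Y` yields a state
  -- outside `Z` that lies in `Y` or has a link into `Z`, and its cycle can be added.
  obtain ⟨Z, ⟨hZ, hblock⟩, hmax⟩ := Set.exists_max_image
    {Z : Set X | (∀ x, π x ∈ Z ↔ x ∈ Z) ∧ HasObservableBlock R Y Z} Set.ncard (Set.toFinite _)
    ⟨∅, by simp, 0, by simp, fun c z _ _ h => funext fun x => h x (Set.notMem_empty x)⟩
  have huniv : ∀ x, x ∈ Z := by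
    by_contra! hx
    obtain ⟨x, hx⟩ := hx
    obtain ⟨j, hj, hlink⟩ : ∃ j, j ∉ Z ∧ (j ∈ Y ∨ ∃ i ∈ Z, R i j) := by
      obtain ⟨y, hyY, hxy⟩ := hpath x
      induction hxy using Relation.ReflTransGen.head_induction_on with
      | refl => exact ⟨y, hx, Or.inl hyY⟩
      | @head a b hab _ ih =>
        by_cases hb : b ∈ Z
        · exact ⟨a, hx, Or.inr ⟨b, hb, hab⟩⟩
        · exact ih hb
    have hle := hmax _ ⟨fun x => ?_, hblock.extend π hπ hZ hj hlink⟩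
    · have hss : Z ⊂ Z ∪ {k | π.SameCycle j k} := by
        refine ⟨Set.subset_union_left, fun h => hj (h (Or.inr ?_))⟩
        exact Equiv.Perm.SameCycle.refl _ _
      exact absurd hle (not_le.2 (Set.ncard_lt_ncard hss (Set.toFinite _)))
    · exact or_congr (hZ x) Equiv.Perm.sameCycle_apply_right
  obtain ⟨A, hA, hno⟩ := hblock
  -- Entries outside the pattern occur only in columns of `Y`; erasing them does not affect vectors
  -- that vanish on `Y`.
  refine ⟨Matrix.of fun a b => if R a b then A a b else 0, fun a b hab => ?_, ?_⟩
  · by_contra hR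
    simp [hR] at hab
  · intro c z hz hzY
    refine hno c z ?_ hzY fun x hx => absurd (huniv x) hx
    rw [← hz]
    ext a
    refine Finset.sum_congr rfl fun b _ => ?_
    by_cases hR : R a b
    · simp [hR]
    · by_cases hb : b ∈ Y
      · simp [hzY b hb]
      · have : A a b = 0 := by
          by_contra hne
          exact (hA a b hne).2.2.elim hb hR
        simp [this]

end

/-! ### Positive eigenvectors of irreducible nonnegative matrices -/

section

variable {ι : Type*} [Fintype ι] [DecidableEq ι]

lemma pow_apply_nonneg {B : Matrix ι ι ℝ} (hB : ∀ i j, 0 ≤ B i j) (k : ℕ) (i j : ι) :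
    0 ≤ (B ^ k) i j := by
  induction k generalizing i j with
  | zero => rw [pow_zero, Matrix.one_apply]; split_ifs <;> norm_num
  | succ k ih =>
    rw [pow_succ, Matrix.mul_apply]
    exact Finset.sum_nonneg fun l _ => mul_nonneg (ih i l) (hB l j)

lemma exists_pow_apply_pos {B : Matrix ι ι ℝ} (hB : ∀ i j, 0 ≤ B i j) {G : ι → ι → Prop}
    (hG : ∀ i j, G i j → 0 < B i j) {i j : ι} (h : HasPath G j i) : ∃ k, 0 < (B ^ k) i j := by
  induction h with
  | refl => exact ⟨0, by simp⟩
  | @tail b c _ hbc ih =>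
    obtain ⟨k, hk⟩ := ih
    refine ⟨k + 1, ?_⟩
    rw [pow_succ', Matrix.mul_apply]
    exact Finset.sum_pos' (fun l _ => mul_nonneg (hB c l) (pow_apply_nonneg hB k l j))
      ⟨b, Finset.mem_univ _, mul_pos (hG c b hbc) hk⟩

/-- The Perron vector of an irreducible nonnegative matrix with a positive diagonal. -/
lemma exists_perron_vector [Nonempty ι] {B : Matrix ι ι ℝ} (hB : ∀ i j, 0 ≤ B i j)
    (hdiag : ∀ i, 0 < B i i) (hirr : ∀ i j, ∃ k, 0 < (B ^ k) i j) :
    ∃ (ρ : ℝ) (r : ι → ℝ), 0 < ρ ∧ (∀ i, 0 < r i) ∧ B *ᵥ r = ρ • r := by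
  choose k hk using hirr
  -- `C` is entrywise positive and commutes with `B`; it turns nonzero nonnegative vectors into
  -- positive ones.
  set C : Matrix ι ι ℝ := ∑ p : ι × ι, B ^ k p.1 p.2 with hC
  have hCapp : ∀ i j, C i j = ∑ p : ι × ι, (B ^ k p.1 p.2) i j := fun i j => by
    rw [hC, Matrix.sum_apply]
  have hCpos : ∀ i j, 0 < C i j := fun i j => by
    rw [hCapp]
    exact Finset.sum_pos' (fun p _ => pow_apply_nonneg hB _ i j)
      ⟨(i, j), Finset.mem_univ _, hk i j⟩
  have hcomm : B * C = C * B := by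
    rw [hC, Finset.mul_sum, Finset.sum_mul]
    exact Finset.sum_congr rfl fun p _ => (Commute.self_pow B _).eq
  have hmulpos : ∀ x : ι → ℝ, (∀ i, 0 ≤ x i) → x ≠ 0 → ∀ i, 0 < (C *ᵥ x) i := by
    intro x hx hne i
    obtain ⟨j, hj⟩ := Function.ne_iff.1 hne
    exact Finset.sum_pos' (fun l _ => mul_nonneg (hCpos i l).le (hx l))
      ⟨j, Finset.mem_univ _, mul_pos (hCpos i j) (lt_of_le_of_ne (hx j) (Ne.symm hj))⟩
  -- Collatz–Wielandt: `ρ` is the largest first coordinate on this compact set.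
  set S : Set (ℝ × (ι → ℝ)) := {p | 0 ≤ p.1 ∧ (∀ i, 0 ≤ p.2 i) ∧ ∑ i, p.2 i = 1 ∧
    ∀ i, p.1 * p.2 i ≤ (B *ᵥ p.2) i} with hS
  have hclosed : IsClosed S := by
    have h1 : ∀ i : ι, Continuous fun p : ℝ × (ι → ℝ) => (B *ᵥ p.2) i := fun i =>
      continuous_finsetSum _ fun j _ => by fun_prop
    refine IsClosed.inter (isClosed_le continuous_const continuous_fst) (IsClosed.inter ?_
      (IsClosed.inter (isClosed_eq (by fun_prop) continuous_const) ?_))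
    · have : {p : ℝ × (ι → ℝ) | ∀ i, 0 ≤ p.2 i} = ⋂ i, {p : ℝ × (ι → ℝ) | 0 ≤ p.2 i} := by
        ext; simp
      change IsClosed {p : ℝ × (ι → ℝ) | ∀ i, 0 ≤ p.2 i}
      rw [this]
      exact isClosed_iInter fun i => isClosed_le continuous_const (by fun_prop)
    · have : {p : ℝ × (ι → ℝ) | ∀ i, p.1 * p.2 i ≤ (B *ᵥ p.2) i} =
          ⋂ i, {p : ℝ × (ι → ℝ) | p.1 * p.2 i ≤ (B *ᵥ p.2) i} := by
        ext; simp
      change IsClosed {p : ℝ × (ι → ℝ) | ∀ i, p.1 * p.2 i ≤ (B *ᵥ p.2) i}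
      rw [this]
      exact isClosed_iInter fun i => isClosed_le (by fun_prop) (h1 i)
  have hle1 : ∀ p ∈ S, ∀ i, p.2 i ≤ 1 := fun p hp i => by
    rw [← hp.2.2.1]
    exact Finset.single_le_sum (fun j _ => hp.2.1 j) (Finset.mem_univ i)
  have hsub : S ⊆ Set.Icc ((0 : ℝ), (0 : ι → ℝ)) (∑ i, ∑ j, B i j, 1) := by
    intro p hp
    refine ⟨⟨hp.1, fun i => hp.2.1 i⟩, ⟨?_, fun i => hle1 p hp i⟩⟩
    calc p.1 = ∑ i, p.1 * p.2 i := by rw [← Finset.mul_sum, hp.2.2.1, mul_one]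
      _ ≤ ∑ i, (B *ᵥ p.2) i := Finset.sum_le_sum fun i _ => hp.2.2.2 i
      _ ≤ ∑ i, ∑ j, B i j := Finset.sum_le_sum fun i _ => Finset.sum_le_sum fun j _ =>
          mul_le_of_le_one_right (hB i j) (hle1 p hp j)
  have hcompact : IsCompact S := isCompact_Icc.of_isClosed_subset hclosed hsub
  have hSne : S.Nonempty := by
    have i₀ := Classical.arbitrary ι
    refine ⟨(0, Pi.single i₀ 1), le_rfl, fun i => ?_, by simp, fun i => ?_⟩
    · by_cases h : i = i₀ <;> simp [h]
    · simp [hB]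
  obtain ⟨⟨ρ, r⟩, hmem, hmax⟩ := hcompact.exists_isMaxOn hSne continuous_fst.continuousOn
  obtain ⟨hρ, hr, hsum, hle⟩ := hmem
  simp only at hρ hr hsum hle
  have hr0 : r ≠ 0 := by
    rintro rfl
    simp at hsum
  have heig : B *ᵥ r = ρ • r := by
    by_contra hne
    -- A nonzero slack `y` would become positive under `C`, so the normalized `C r` would allow the
    -- larger value `ρ + δ`.
    set y : ι → ℝ := B *ᵥ r - ρ • r with hy
    have hCy := hmulpos y (fun i => sub_nonneg.2 (hle i)) (sub_ne_zero.2 hne)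
    have hCr := hmulpos r hr hr0
    obtain ⟨i₀, -, hi₀⟩ := Finset.exists_min_image Finset.univ
      (fun i => (C *ᵥ y) i / (C *ᵥ r) i) Finset.univ_nonempty
    set δ := (C *ᵥ y) i₀ / (C *ᵥ r) i₀ with hδ
    have hδ0 : 0 < δ := div_pos (hCy i₀) (hCr i₀)
    set s := ∑ i, (C *ᵥ r) i with hs
    have hs0 : 0 < s := Finset.sum_pos (fun i _ => hCr i) Finset.univ_nonempty
    have hBC : ∀ i, (B *ᵥ (C *ᵥ r)) i = ρ * (C *ᵥ r) i + (C *ᵥ y) i := by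
      intro i
      have : B *ᵥ (C *ᵥ r) = ρ • (C *ᵥ r) + C *ᵥ y := by
        rw [hy, Matrix.mulVec_sub, Matrix.mulVec_smul, Matrix.mulVec_mulVec, Matrix.mulVec_mulVec,
          hcomm]
        abel
      rw [this]
      rfl
    have hin : (ρ + δ, s⁻¹ • (C *ᵥ r)) ∈ S := by
      refine ⟨by positivity, fun i => ?_, ?_, fun i => ?_⟩
      · exact mul_nonneg (inv_nonneg.2 hs0.le) (hCr i).le
      · simp only [Pi.smul_apply, smul_eq_mul, ← Finset.mul_sum]
        exact inv_mul_cancel₀ hs0.ne'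
      · simp only [Matrix.mulVec_smul, Pi.smul_apply, smul_eq_mul]
        rw [hBC, mul_left_comm]
        refine mul_le_mul_of_nonneg_left ?_ (inv_nonneg.2 hs0.le)
        have := (le_div_iff₀ (hCr i)).1 (hi₀ i (Finset.mem_univ _))
        linarith
    have := hmax hin
    change ρ + δ ≤ ρ at this
    linarith
  have hpos : ∀ i, 0 < r i := by
    intro i
    have h1 : C *ᵥ r = (∑ p : ι × ι, ρ ^ k p.1 p.2) • r := by
      rw [hC, Matrix.sum_mulVec, Finset.sum_smul]
      exact Finset.sum_congr rfl fun p _ => pow_mulVec_of_eigen B ρ r heig _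
    have h2 := hmulpos r hr hr0 i
    rw [h1] at h2
    refine lt_of_le_of_ne (hr i) fun h => ?_
    simp [← h] at h2
  refine ⟨ρ, r, ?_, hpos, heig⟩
  have i₀ := Classical.arbitrary ι
  have h1 : 0 < (B *ᵥ r) i₀ := Finset.sum_pos' (fun j _ => mul_nonneg (hB i₀ j) (hr j))
    ⟨i₀, Finset.mem_univ _, mul_pos (hdiag i₀) (hpos i₀)⟩
  rw [heig] at h1
  exact pos_of_mul_pos_left h1 (hr i₀)

end

/-! ### Weight matrices with simple spectrum and full eigenvectors -/

section

variable {ι : Type*} [Fintype ι] [DecidableEq ι]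

/-- A form of the discriminant of the characteristic polynomial: it does not vanish iff the
eigenvalues are simple. -/
noncomputable def charDisc {R : Type*} [CommRing R] (M : Matrix ι ι R) : R :=
  (Polynomial.aeval M (Polynomial.derivative M.charpoly)).det

/-- Makes simplicity of the spectrum a polynomial condition: the universal matrix can be evaluated
at parameters, and a real matrix complexified. -/
lemma charDisc_map {R S : Type*} [CommRing R] [CommRing S] (φ : R →+* S) (M : Matrix ι ι R) :
    charDisc (M.map φ) = φ (charDisc M) := by
  unfold charDisc
  rw [RingHom.map_det, Matrix.charpoly_map, Polynomial.derivative_map]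
  congr 1
  refine (Polynomial.map_aeval_eq_aeval_map (φ := φ) (ψ := (φ.mapMatrix : Matrix ι ι R →+* Matrix ι ι S)) ?_ _ _).symm
  ext r i j
  by_cases h : i = j <;> simp [Matrix.algebraMap_matrix_apply, h]

lemma aeval_mulVec_of_eigen {R : Type*} [CommRing R] (M : Matrix ι ι R) (c : R) (z : ι → R)
    (h : M *ᵥ z = c • z) (p : Polynomial R) :
    (Polynomial.aeval M p) *ᵥ z = p.eval c • z := by
  rw [Polynomial.aeval_eq_sum_range, Polynomial.eval_eq_sum_range, Matrix.sum_mulVec,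
    Finset.sum_smul]
  refine Finset.sum_congr rfl fun k _ => ?_
  rw [Matrix.smul_mulVec, pow_mulVec_of_eigen M c z h, smul_smul]

/-- `χ'(D)` is diagonal with entries `χ'(d i)`, nonzero because `χ` is separable. -/
lemma charDisc_diagonal_ne_zero {K : Type*} [Field K] (d : ι → K) (hd : Function.Injective d) :
    charDisc (Matrix.diagonal d) ≠ 0 := by
  unfold charDisc
  intro h
  obtain ⟨v, hv, h0⟩ := Matrix.exists_mulVec_eq_zero_iff.2 h
  obtain ⟨i, hi⟩ := Function.ne_iff.1 hv
  set p := (Matrix.diagonal d).charpoly with hp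
  have hdiag : Polynomial.aeval (Matrix.diagonal d) (Polynomial.derivative p) =
      Matrix.diagonal (fun i => (Polynomial.derivative p).eval (d i)) := by
    have := Polynomial.aeval_algHom_apply (Matrix.diagonalAlgHom (n := ι) (α := K) K) d
      (Polynomial.derivative p)
    rw [Matrix.diagonalAlgHom_apply, Matrix.diagonalAlgHom_apply] at this
    rw [this]
    congr 1
    ext i
    rw [Polynomial.aeval_fn_apply, Polynomial.aeval_def, Polynomial.eval₂_eq_eval_map,
      Algebra.algebraMap_self, Polynomial.map_id]
  have hsep : p.Separable := by
    rw [hp, Matrix.charpoly_diagonal]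
    exact Polynomial.separable_prod_X_sub_C_iff.2 hd
  have hroot : Polynomial.aeval (d i) p = 0 := by
    rw [hp, Matrix.charpoly_diagonal, map_prod]
    exact Finset.prod_eq_zero (Finset.mem_univ i) (by simp)
  have h1 := hsep.aeval_derivative_ne_zero hroot
  have h2 := congrFun h0 i
  rw [hdiag, Matrix.mulVec_diagonal] at h2
  rw [Polynomial.coe_aeval_eq_eval] at h1
  exact (mul_ne_zero h1 hi) h2

/-- An eigenvector for a multiple root of `χ` would be killed by `χ'(M)`. So all roots are simple,
and their eigenvectors form a basis. -/
lemma exists_eigenbasis (M : Matrix ι ι ℂ) (hdisc : charDisc M ≠ 0) :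
    ∃ (μ : ι → ℂ) (b : Module.Basis ι ℂ (ι → ℂ)), Function.Injective μ ∧
      ∀ k, M *ᵥ b k = μ k • b k := by
  have hev : ∀ c : ℂ, M.charpoly.IsRoot c → ∃ z : ι → ℂ, z ≠ 0 ∧ M *ᵥ z = c • z := by
    intro c hc
    have h1 : (Matrix.scalar ι c - M).det = 0 := by
      rw [← Matrix.eval_charpoly]; exact hc
    obtain ⟨z, hz, h0⟩ := Matrix.exists_mulVec_eq_zero_iff.2 h1
    refine ⟨z, hz, ?_⟩
    rw [Matrix.sub_mulVec, sub_eq_zero] at h0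
    rw [← h0]
    simp [Matrix.scalar_apply, ← Matrix.smul_one_eq_diagonal, Matrix.smul_mulVec]
  have hχ0 : M.charpoly ≠ 0 := M.charpoly_monic.ne_zero
  have hnodup : M.charpoly.roots.Nodup := by
    rw [Multiset.nodup_iff_count_le_one]
    intro c
    rw [Polynomial.count_roots]
    by_contra! hlt
    obtain ⟨h1, h2⟩ := (Polynomial.one_lt_rootMultiplicity_iff_isRoot hχ0).1 hlt
    obtain ⟨z, hz, h0⟩ := hev c h1
    refine hdisc (Matrix.exists_mulVec_eq_zero_iff.1 ⟨z, hz, ?_⟩)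
    rw [aeval_mulVec_of_eigen M c z h0, h2, zero_smul]
  have hcard : Fintype.card ι = Fintype.card M.charpoly.roots.toFinset := by
    rw [Fintype.card_coe, Multiset.toFinset_card_of_nodup hnodup,
      IsAlgClosed.card_roots_eq_natDegree, Matrix.charpoly_natDegree_eq_dim]
  obtain ⟨e⟩ := Fintype.card_eq.1 hcard
  have hroot : ∀ k, M.charpoly.IsRoot (e k).1 := fun k =>
    (Polynomial.mem_roots hχ0).1 (Multiset.mem_toFinset.1 (e k).2)
  choose z hz hMz using fun k => hev _ (hroot k)
  have hμ : Function.Injective fun k => (e k).1 := Subtype.val_injective.comp e.injective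
  have hli : LinearIndependent ℂ z := by
    refine Module.End.eigenvectors_linearIndependent' (Matrix.toLin' M) (fun k => (e k).1) hμ z
      fun k => ⟨?_, hz k⟩
    rw [Module.End.mem_eigenspace_iff]
    exact hMz k
  have hfin : Fintype.card ι = Module.finrank ℂ (ι → ℂ) := by simp
  rcases isEmpty_or_nonempty ι with hι | hι
  · exact ⟨fun k => (e k).1, Pi.basisFun ℂ ι, hμ, fun k => hι.elim k⟩
  · exact ⟨fun k => (e k).1, basisOfLinearIndependentOfCardEqFinrank hli hfin, hμ, fun k => by
      rw [coe_basisOfLinearIndependentOfCardEqFinrank]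
      exact hMz k⟩

/-- The universal matrix with a given zero pattern. -/
noncomputable def universalMatrix {X V : Type*} [AddCommGroup V] [Module ℝ V] (E : X → X → Prop)
    (φ : X → X → V →ₗ[ℝ] ℝ) : Matrix X X (polyFn V) :=
  open Classical in Matrix.of fun i j => if E i j then polyFn.lin (φ i j) else 0

lemma universalMatrix_map {X V : Type*} [AddCommGroup V] [Module ℝ V] (E : X → X → Prop)
    (φ : X → X → V →ₗ[ℝ] ℝ) (θ : V) :
    (universalMatrix E φ).map (polyFn.ev θ) = systemMatrix E fun i j => φ i j θ := by
  ext i j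
  by_cases h : E i j <;> simp [universalMatrix, systemMatrix, h]

/-- The coordinate functionals on the space of the values of the entries of a matrix. -/
def entry {X : Type*} (i j : X) : (X → X → ℝ) →ₗ[ℝ] ℝ where
  toFun w := w i j
  map_add' _ _ := rfl
  map_smul' _ _ := rfl

lemma systemMatrix_of_pattern {X : Type*} {E : X → X → Prop} {A : Matrix X X ℝ}
    (h : ∀ i j, A i j ≠ 0 → E i j) : systemMatrix E (fun i j => A i j) = A := by
  ext i j
  by_cases hE : E i j
  · simp [systemMatrix, hE]
  · have : A i j = 0 := by
      by_contra hne
      exact hE (h i j hne)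
    simp [systemMatrix, hE, this]

/-- A strongly connected network has row-stochastic weights (on the links and the diagonal, up
to sign conditions) with simple spectrum and eigenvectors without zero entries. -/
lemma exists_stochastic_eigenbasis [Nonempty ι] (G : ι → ι → Prop)
    (hG : ∀ i j, HasPath G i j) :
    ∃ (W : Matrix ι ι ℝ) (μ : ι → ℂ) (b : Module.Basis ι ℂ (ι → ℂ)),
      (∀ i j, i ≠ j → W i j ≠ 0 → G i j) ∧ (∀ i, ∑ j, W i j = 1) ∧ Function.Injective μ ∧
      (∀ k, cplx W *ᵥ b k = μ k • b k) ∧ ∀ k i, b k i ≠ 0 := by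
  set G' : ι → ι → Prop := fun i j => i = j ∨ G i j with hG'
  have hG'path : ∀ i j, HasPath G' i j := fun i j =>
    Relation.ReflTransGen.mono (fun _ _ h => Or.inr h) _ _ (hG i j)
  set F := universalMatrix G' (entry (X := ι)) with hF
  have hFmap : ∀ w : ι → ι → ℝ, F.map (polyFn.ev w) = systemMatrix G' w := fun w =>
    universalMatrix_map G' _ w
  -- An eigenvector with a zero entry at `j` would be hidden from `{j}`. The self-loops of `G'` are
  -- the spanning cycles, so the identity permutation serves.
  have hobs : ∀ᵐ w : ι → ι → ℝ, ∀ j, NoHidden (systemMatrix G' w) {j} := by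
    rw [ae_all_iff]
    intro j
    obtain ⟨A, hA, hno⟩ := exists_noHidden G' {j} 1 (fun k => Or.inr (Or.inl rfl))
      fun x => ⟨j, rfl, hG'path x j⟩
    have := ae_noHidden (volume : Measure (ι → ι → ℝ)) F {j} (fun i k => A i k) (by
      rw [hFmap, systemMatrix_of_pattern hA]; exact hno)
    simpa only [hFmap] using this
  have hdisc : ∀ᵐ w : ι → ι → ℝ, charDisc (systemMatrix G' w) ≠ 0 := by
    have hd : Function.Injective fun i : ι => ((Fintype.equivFin ι i : ℕ) : ℝ) := fun a b h =>
      (Fintype.equivFin ι).injective (Fin.ext (Nat.cast_injective h))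
    have := polyFn.ae_ne_zero (volume : Measure (ι → ι → ℝ)) (charDisc F)
      (fun i j => Matrix.diagonal (fun i : ι => ((Fintype.equivFin ι i : ℕ) : ℝ)) i j) (by
        rw [← charDisc_map, hFmap, systemMatrix_of_pattern]
        · exact charDisc_diagonal_ne_zero _ hd
        · intro i j hij
          by_contra h
          exact hij (Matrix.diagonal_apply_ne _ fun hh => h (Or.inl hh)))
    simpa only [← charDisc_map, hFmap] using this
  obtain ⟨w, hwpos, hwobs, hwdisc⟩ : ∃ w : ι → ι → ℝ, (∀ i j, 0 < w i j) ∧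
      (∀ j, NoHidden (systemMatrix G' w) {j}) ∧ charDisc (systemMatrix G' w) ≠ 0 := by
    have hopen : IsOpen (Set.pi Set.univ fun _ : ι => Set.pi Set.univ fun _ : ι =>
        Set.Ioi (0 : ℝ)) :=
      isOpen_set_pi Set.finite_univ fun _ _ => isOpen_set_pi Set.finite_univ fun _ _ => isOpen_Ioi
    obtain ⟨w, hw, hw'⟩ := (Measure.dense_of_ae (hobs.and hdisc)).inter_open_nonempty _ hopen
      ⟨fun _ _ => 1, fun _ _ _ _ => Set.mem_Ioi.2 one_pos⟩
    exact ⟨w, fun i j => hw i trivial j trivial, hw'⟩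
  set B := systemMatrix G' w with hB
  have hBpos : ∀ i j, G' i j → 0 < B i j := fun i j h => by simp [hB, systemMatrix, h, hwpos]
  have hB0 : ∀ i j, ¬ G' i j → B i j = 0 := fun i j h => by simp [hB, systemMatrix, h]
  have hBnonneg : ∀ i j, 0 ≤ B i j := fun i j => by
    by_cases h : G' i j
    · exact (hBpos i j h).le
    · exact (hB0 i j h).ge
  obtain ⟨ρ, r, hρ, hr, heig⟩ := exists_perron_vector hBnonneg (fun i => hBpos i i (Or.inl rfl))
    fun i j => exists_pow_apply_pos hBnonneg hBpos (hG'path j i)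
  obtain ⟨μ, b, hμ, hb⟩ := exists_eigenbasis (cplx B) (by
    rw [charDisc_map]
    simpa using hwdisc)
  have hbne : ∀ k i, b k i ≠ 0 := by
    intro k i h
    refine b.ne_zero k (hwobs i (μ k) (b k) (hb k) fun y hy => ?_)
    rw [Set.mem_singleton_iff.1 hy, h]
  have hrC : ∀ i, (r i : ℂ) ≠ 0 := fun i => Complex.ofReal_ne_zero.2 (hr i).ne'
  have hρC : (ρ : ℂ) ≠ 0 := Complex.ofReal_ne_zero.2 hρ.ne'
  let T : (ι → ℂ) ≃ₗ[ℂ] (ι → ℂ) :=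
    LinearEquiv.piCongrRight fun i => LinearEquiv.smulOfNeZero ℂ ℂ (r i : ℂ)⁻¹ (inv_ne_zero (hrC i))
  have hT : ∀ v i, T v i = (r i : ℂ)⁻¹ * v i := fun v i => rfl
  -- Conjugating by the diagonal Perron vector and dividing by `ρ` makes the row sums one, and keeps
  -- the spectrum simple and the eigenvectors free of zeros.
  refine ⟨Matrix.of fun i j => ρ⁻¹ * (r i)⁻¹ * B i j * r j, fun k => (ρ : ℂ)⁻¹ * μ k, b.map T,
    ?_, ?_, ?_, ?_, ?_⟩
  · intro i j hij h
    by_contra hg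
    have : B i j = 0 := hB0 i j fun hh => hh.elim hij hg
    simp [this] at h
  · intro i
    have h1 : ∑ j, B i j * r j = ρ * r i := congrFun heig i
    simp only [Matrix.of_apply, mul_assoc, ← Finset.mul_sum]
    rw [h1]
    have := (hr i).ne'
    field_simp
  · intro k l h
    exact hμ (mul_left_cancel₀ (inv_ne_zero hρC) h)
  · intro k
    ext i
    have h1 : ∑ j, (B i j : ℂ) * b k j = μ k * b k i := congrFun (hb k) i
    have h2 : ∀ j, ((ρ⁻¹ * (r i)⁻¹ * B i j * r j : ℝ) : ℂ) * ((r j : ℂ)⁻¹ * b k j) =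
        (ρ : ℂ)⁻¹ * (r i : ℂ)⁻¹ * ((B i j : ℂ) * b k j) := fun j => by
      have := hrC j
      push_cast
      field_simp
    calc _ = ∑ j, ((ρ⁻¹ * (r i)⁻¹ * B i j * r j : ℝ) : ℂ) * ((r j : ℂ)⁻¹ * b k j) := rfl
      _ = _ := by
        simp only [h2, ← Finset.mul_sum, h1, Pi.smul_apply, Module.Basis.map_apply, hT, smul_eq_mul]
        ring
  · intro k i
    rw [Module.Basis.map_apply, hT]
    exact mul_ne_zero (inv_ne_zero (hrC i)) (hbne k i)

end

/-! ### The networked system -/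

section

variable {ι X : Type*} [Fintype ι] [DecidableEq ι] [Fintype X] [DecidableEq X]

lemma finite_setOf_affine_eq_zero {a b : ℂ} (h : a ≠ 0 ∨ b ≠ 0) :
    {ε : ℝ | a + b * ε = 0}.Finite := by
  refine Set.Subsingleton.finite fun x hx y hy => ?_
  have hx' : a + b * x = 0 := hx
  have hy' : a + b * y = 0 := hy
  by_cases hb : b = 0
  · simp [hb] at hx' h
    exact absurd hx' h
  · have : b * x = b * y := by linear_combination hx' - hy'
    exact Complex.ofReal_injective (mul_left_cancel₀ hb this)

/-- A stochastic matrix with the given pattern can be scaled towards the identity. -/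
lemma weightMatrix_smul (G : ι → ι → Prop) (W : Matrix ι ι ℝ)
    (hW : ∀ i j, i ≠ j → W i j ≠ 0 → G i j) (hsum : ∀ i, ∑ j, W i j = 1) (ε : ℝ) :
    weightMatrix G (fun i j => ε * W i j) = (1 - ε) • (1 : Matrix ι ι ℝ) + ε • W := by
  classical
  ext i j
  by_cases hij : i = j
  · subst hij
    have h1 : ∑ k ∈ Finset.univ.filter (fun k => k ≠ i ∧ G i k), ε * W i k =
        ε * (1 - W i i) := by
      rw [← Finset.mul_sum, ← hsum i, ← Finset.add_sum_erase _ _ (Finset.mem_univ i),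
        add_sub_cancel_left]
      congr 1
      refine Finset.sum_subset (fun k hk => ?_) fun k hk hk' => ?_
      · exact Finset.mem_erase.2 ⟨(Finset.mem_filter.1 hk).2.1, Finset.mem_univ k⟩
      · by_contra hne
        have hki := (Finset.mem_erase.1 hk).1
        exact hk' (Finset.mem_filter.2 ⟨Finset.mem_univ k, hki, hW i k hki.symm hne⟩)
    have h2 : weightMatrix G (fun i j => ε * W i j) i i =
        1 - ∑ k ∈ Finset.univ.filter (fun k => k ≠ i ∧ G i k), ε * W i k := by
      simp only [weightMatrix, Matrix.of_apply, if_true]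
      congr!
    rw [h2, h1]
    simp only [Matrix.add_apply, Matrix.smul_apply, Matrix.one_apply_eq, smul_eq_mul]
    ring
  · have h1 : W i j = 0 ∨ G i j := by
      by_cases h : W i j = 0
      · exact Or.inl h
      · exact Or.inr (hW i j hij h)
    rcases h1 with h | h <;> simp [weightMatrix, hij, h]

/-- The weights of a strongly connected network can be chosen so that the networked system is
observable. -/
lemma exists_weights_of_stronglyConnected [Nonempty ι] (G : ι → ι → Prop)
    (hG : ∀ i j, HasPath G i j) (A : Matrix X X ℝ) (M : ι → Set X)
    (hker : ∀ i (z : X → ℂ), cplx A *ᵥ z = 0 → (∀ x ∈ M i, z x = 0) → z = 0)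
    (hno : NoHidden A (⋃ i, M i)) :
    ∃ w : ι → ι → ℝ, ∀ (c : ℂ) (V : ι → X → ℂ),
      (∀ i x, ∑ j, (weightMatrix G w i j : ℂ) * (cplx A *ᵥ V j) x = c * V i x) →
      (∀ i, ∀ x ∈ M i, V i x = 0) → V = 0 := by
  obtain ⟨W, μ, b, hW, hsum, hμ, hb, hbne⟩ := exists_stochastic_eigenbasis G hG
  set Λ : Set ℂ := {α | (cplx A).charpoly.IsRoot α} with hΛ
  have hΛfin : Λ.Finite := Polynomial.finite_setOfPred_isRoot (cplx A).charpoly_monic.ne_zero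
  have hΛmem : ∀ (α : ℂ) (z : X → ℂ), z ≠ 0 → cplx A *ᵥ z = α • z → α ∈ Λ := by
    intro α z hz h
    change (cplx A).charpoly.eval α = 0
    rw [Matrix.eval_charpoly]
    refine Matrix.exists_mulVec_eq_zero_iff.1 ⟨z, hz, ?_⟩
    rw [Matrix.sub_mulVec, h, sub_eq_zero]
    simp [Matrix.scalar_apply, ← Matrix.smul_one_eq_diagonal, Matrix.smul_mulVec]
  -- The second condition says `α * ν k ≠ β * ν l` for `ν k = 1 + (μ k - 1) * ε`. Each condition
  -- excludes at most one `ε`: for `α = β ≠ 0` the slope is `α * (μ k - μ l) ≠ 0`.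
  obtain ⟨ε, hε0, hεΛ⟩ : ∃ ε : ℝ, (∀ k, (1 : ℂ) + (μ k - 1) * ε ≠ 0) ∧
      ∀ α ∈ Λ, α ≠ 0 → ∀ β ∈ Λ, ∀ k l, k ≠ l →
        (α - β) + (α * (μ k - 1) - β * (μ l - 1)) * ε ≠ 0 := by
    set S₁ : Set ℝ := ⋃ k, {ε : ℝ | (1 : ℂ) + (μ k - 1) * ε = 0} with hS₁
    set S₂ : Set ℝ := ⋃ α ∈ Λ \ {0}, ⋃ β ∈ Λ, ⋃ k, ⋃ l ∈ {l : ι | k ≠ l},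
      {ε : ℝ | (α - β) + (α * (μ k - 1) - β * (μ l - 1)) * (ε : ℂ) = 0} with hS₂
    have h₁ : S₁.Finite := Set.finite_iUnion fun k =>
      finite_setOf_affine_eq_zero (Or.inl one_ne_zero)
    have h₂ : S₂.Finite := by
      refine Set.Finite.biUnion (hΛfin.subset Set.sdiff_subset) fun α hα =>
        Set.Finite.biUnion hΛfin fun β _ => Set.finite_iUnion fun k =>
          Set.Finite.biUnion (Set.toFinite _) fun l hl => finite_setOf_affine_eq_zero ?_
      by_cases hαβ : α = β
      · right
        subst hαβ
        rw [← mul_sub, sub_sub_sub_cancel_right]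
        exact mul_ne_zero hα.2 (sub_ne_zero.2 fun h => hl (hμ h))
      · exact Or.inl (sub_ne_zero.2 hαβ)
    obtain ⟨ε, hε⟩ := (h₁.union h₂).infinite_compl.nonempty
    refine ⟨ε, fun k h => hε (Or.inl (Set.mem_iUnion.2 ⟨k, h⟩)), fun α hα hα0 β hβ k l hkl h => ?_⟩
    refine hε (Or.inr ?_)
    simp only [hS₂, Set.mem_iUnion]
    exact ⟨α, ⟨hα, hα0⟩, β, hβ, k, l, hkl, h⟩
  refine ⟨fun i j => ε * W i j, fun c V hV hVM => ?_⟩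
  rw [weightMatrix_smul G W hW hsum ε] at hV
  set W' : Matrix ι ι ℝ := (1 - ε) • (1 : Matrix ι ι ℝ) + ε • W with hW'
  set ν : ι → ℂ := fun k => 1 + (μ k - 1) * ε with hν
  have hbν : ∀ k, cplx W' *ᵥ b k = ν k • b k := by
    intro k
    have h1 : cplx W' = (1 - (ε : ℂ)) • (1 : Matrix ι ι ℂ) + (ε : ℂ) • cplx W := by
      ext i j
      by_cases h : i = j <;> simp [hW', h]
    rw [h1, Matrix.add_mulVec, Matrix.smul_mulVec, Matrix.smul_mulVec, Matrix.one_mulVec, hb,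
      smul_smul, ← add_smul]
    congr 1
    simp only [hν]
    ring
  have hcoord : ∀ k (v : ι → ℂ), b.coord k (cplx W' *ᵥ v) = ν k * b.coord k v := by
    intro k v
    have : (b.coord k).comp (Matrix.mulVecLin (cplx W')) = ν k • b.coord k := by
      refine b.ext fun l => ?_
      rw [LinearMap.comp_apply, Matrix.mulVecLin_apply, hbν, map_smul, LinearMap.smul_apply]
      by_cases h : l = k
      · rw [h]
      · simp [Module.Basis.coord_apply, h]
    exact LinearMap.congr_fun this v
  set u : X → ι → ℂ := fun x i => V i x with hu
  set y : ι → X → ℂ := fun k x => b.coord k (u x) with hy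
  have hAu : ∀ x, (fun j => (cplx A *ᵥ V j) x) = ∑ x', (A x x' : ℂ) • u x' := by
    intro x
    ext j
    simp [Matrix.mulVec, dotProduct, hu]
  have hAy : ∀ k x, b.coord k (fun j => (cplx A *ᵥ V j) x) = (cplx A *ᵥ y k) x := by
    intro k x
    rw [hAu, map_sum]
    simp only [map_smul]
    rfl
  have heq : ∀ k, ν k • (cplx A *ᵥ y k) = c • y k := by
    intro k
    ext x
    have h1 : cplx W' *ᵥ (fun j => (cplx A *ᵥ V j) x) = c • u x := funext fun i => hV i x
    have h2 := congrArg (b.coord k) h1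
    rw [hcoord, hAy, map_smul] at h2
    exact h2
  by_cases hc : c = 0
  · ext i x
    refine congrFun (hker i (V i) ?_ (hVM i)) x
    ext x
    have h1 : (fun j => (cplx A *ᵥ V j) x) = 0 := by
      refine b.ext_elem fun k => ?_
      have h2 := congrFun (heq k) x
      rw [hc, zero_smul, Pi.smul_apply, smul_eq_mul] at h2
      have h3 := hAy k x
      rw [(mul_eq_zero.1 h2).resolve_left (hε0 k)] at h3
      rw [map_zero]
      exact h3
    exact congrFun h1 i
  · have heig : ∀ k, cplx A *ᵥ y k = (c / ν k) • y k := by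
      intro k
      have hk : ν k ≠ 0 := hε0 k
      rw [div_eq_inv_mul, mul_smul, ← heq k, smul_smul, inv_mul_cancel₀ hk, one_smul]
    have hyzero : ∀ k, y k = 0 := by
      intro k
      by_contra hk
      have hother : ∀ l, l ≠ k → y l = 0 := by
        intro l hlk
        by_contra hl
        have hk0 : ν k ≠ 0 := hε0 k
        have hl0 : ν l ≠ 0 := hε0 l
        refine hεΛ (c / ν k) (hΛmem _ _ hk (heig k)) (div_ne_zero hc hk0) (c / ν l)
          (hΛmem _ _ hl (heig l)) k l hlk.symm ?_
        have h1 : c / ν k * ν k = c / ν l * ν l := by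
          rw [div_mul_cancel₀ _ hk0, div_mul_cancel₀ _ hl0]
        simp only [hν] at h1 ⊢
        linear_combination h1
      have hVy : ∀ i x, V i x = y k x * b k i := by
        intro i x
        have h1 := congrFun (b.sum_repr (u x)) i
        rw [Finset.sum_apply, Finset.sum_eq_single k] at h1
        · exact h1.symm
        · intro l _ hl
          have : b.repr (u x) l = 0 := congrFun (hother l hl) x
          rw [Pi.smul_apply, this, zero_smul]
        · simp
      refine hk (hno _ _ (heig k) fun x hx => ?_)
      obtain ⟨i, hi⟩ := Set.mem_iUnion.1 hx
      have h1 := hVM i x hi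
      rw [hVy] at h1
      exact (mul_eq_zero.1 h1).resolve_right (hbne k i)
    ext i x
    have : u x = 0 := b.ext_elem fun k => by
      rw [map_zero]
      exact congrFun (hyzero k) x
    exact congrFun this i

end

/-! ### Gluing network components, and generic injectivity -/

section

variable {ι X : Type*} [Fintype ι] [DecidableEq ι] [Fintype X] [DecidableEq X]

/-- The strongly connected component of a node. -/
abbrev sccOf {V : Type*} (G : V → V → Prop) (c : V) : Set V :=
  {i | HasPath G c i ∧ HasPath G i c}

/-- The digraph induced on a set of nodes. -/
def induced {V : Type*} (G : V → V → Prop) (S : Set V) : S → S → Prop := fun i j => G i j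

lemma hasPath_induced_sccOf {V : Type*} (G : V → V → Prop) (c : V) (i j : sccOf G c) :
    HasPath (induced G (sccOf G c)) i j := by
  obtain ⟨j, hj⟩ := j
  have hij : HasPath G i.1 j := Relation.ReflTransGen.trans i.2.2 hj.1
  induction hij with
  | refl => exact Relation.ReflTransGen.refl
  | @tail a b hia hab ih =>
    have ha : a ∈ sccOf G c := ⟨Relation.ReflTransGen.trans i.2.1 hia,
      Relation.ReflTransGen.head hab hj.2⟩
    exact Relation.ReflTransGen.tail (ih ha) (show induced G (sccOf G c) ⟨b, hj⟩ ⟨a, ha⟩ from hab)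

/-- Weights are chosen for the component of each node; a common representative makes the choices
agree within a component. -/
lemma exists_representative {V : Type*} (G : V → V → Prop) :
    ∃ rep : V → V, (∀ i, i ∈ sccOf G (rep i)) ∧ ∀ i j, i ∈ sccOf G (rep j) ↔ rep i = rep j := by
  let S : Setoid V :=
    { r := fun i j => HasPath G i j ∧ HasPath G j i
      iseqv := ⟨fun _ => ⟨Relation.ReflTransGen.refl, Relation.ReflTransGen.refl⟩,
        fun h => ⟨h.2, h.1⟩, fun h h' => ⟨Relation.ReflTransGen.trans h.1 h'.1,
          Relation.ReflTransGen.trans h'.2 h.2⟩⟩ }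
  have hout : ∀ i, i ∈ sccOf G (Quotient.mk S i).out := fun i => Quotient.mk_out (s := S) i
  refine ⟨fun i => (Quotient.mk S i).out, hout, fun i j => ⟨fun h => ?_, fun h => ?_⟩⟩
  · have : Quotient.mk S i = Quotient.mk S j := by
      rw [← Quotient.out_eq (Quotient.mk S j)]
      exact (Quotient.sound h).symm
    simp only [this]
  · have := hout i
    simp only at h
    rwa [h] at this

lemma sum_eq_sum_subtype {ι R : Type*} [Fintype ι] [AddCommMonoid R] (S : Set ι) (f : ι → R)
    (h : ∀ i, i ∉ S → f i = 0) [Fintype S] : ∑ i, f i = ∑ i : S, f i := by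
  classical
  rw [← Finset.sum_subtype (Finset.univ.filter fun i => i ∈ S) (fun i => by simp) f]
  refine (Finset.sum_subset (Finset.filter_subset _ _) fun i _ hi => h i fun hS => hi ?_).symm
  simpa using hS

open Classical in
/-- The weights of a network can be chosen so that the networked system is observable, if each of
its strongly connected components observes the system. -/
lemma exists_weights (G : ι → ι → Prop) (A : Matrix X X ℝ) (M : ι → Set X)
    (hker : ∀ i (z : X → ℂ), cplx A *ᵥ z = 0 → (∀ x ∈ M i, z x = 0) → z = 0)
    (hno : ∀ c, NoHidden A (⋃ i ∈ sccOf G c, M i)) :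
    ∃ w : ι → ι → ℝ, ∀ (c : ℂ) (V : ι → X → ℂ),
      (∀ i x, ∑ j, (weightMatrix G w i j : ℂ) * (cplx A *ᵥ V j) x = c * V i x) →
      (∀ i, ∀ x ∈ M i, V i x = 0) → V = 0 := by
  have hcomp : ∀ c : ι, ∃ w : sccOf G c → sccOf G c → ℝ, ∀ (a : ℂ) (V : sccOf G c → X → ℂ),
      (∀ i x, ∑ j, (weightMatrix (induced G (sccOf G c)) w i j : ℂ) * (cplx A *ᵥ V j) x =
        a * V i x) → (∀ i, ∀ x ∈ M i.1, V i x = 0) → V = 0 := by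
    intro c
    have : Nonempty (sccOf G c) :=
      ⟨⟨c, Relation.ReflTransGen.refl, Relation.ReflTransGen.refl⟩⟩
    refine exists_weights_of_stronglyConnected _ (hasPath_induced_sccOf G c) A (fun i => M i.1)
      (fun i => hker i.1) (noHidden_mono ?_ (hno c))
    intro x hx
    simp only [Set.mem_iUnion] at hx ⊢
    obtain ⟨i, hi, hx⟩ := hx
    exact ⟨⟨i, hi⟩, hx⟩
  choose wc hwc using hcomp
  obtain ⟨rep, hrep, hrep_iff⟩ := exists_representative G
  set w : ι → ι → ℝ := fun i j =>
    if h : i ∈ sccOf G (rep j) then wc (rep j) ⟨i, h⟩ ⟨j, hrep j⟩ else 0 with hw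
  have hw_in : ∀ c i j, rep j = c → ∀ (hi : i ∈ sccOf G c) (hj : j ∈ sccOf G c),
      w i j = wc c ⟨i, hi⟩ ⟨j, hj⟩ := by
    intro c i j hc hi hj
    subst hc
    simp only [hw]
    rw [dif_pos hi]
  have hw_out : ∀ i j, rep i ≠ rep j → w i j = 0 := by
    intro i j h
    simp only [hw]
    rw [dif_neg fun hh => h ((hrep_iff i j).1 hh)]
  refine ⟨w, fun a V hV hVM => ?_⟩
  ext i₀ x₀
  set c := rep i₀ with hc
  have hmem : ∀ i, i ∈ sccOf G c ↔ rep i = c := fun i => hrep_iff i i₀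
  have hin : ∀ i j : sccOf G c, w i j = wc c i j := fun i j =>
    hw_in c i j ((hmem j).1 j.2) i.2 j.2
  have hout : ∀ (i : sccOf G c) j, j ∉ sccOf G c → w i j = 0 := fun i j hj =>
    hw_out i j fun h => hj ((hmem j).2 (h ▸ (hmem i).1 i.2))
  -- Links leaving the component have weight zero, so they do not alter the diagonal entries fixed
  -- by the row sums.
  have hWin : ∀ i j : sccOf G c, weightMatrix G w i j =
      weightMatrix (induced G (sccOf G c)) (wc c) i j := by
    intro i j
    have hsum : ∑ k ∈ Finset.univ.filter (fun k => k ≠ i.1 ∧ G i.1 k), w i.1 k =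
        ∑ k ∈ Finset.univ.filter (fun k : sccOf G c => k ≠ i ∧ induced G (sccOf G c) i k),
          wc c i k := by
      rw [Finset.sum_filter, Finset.sum_filter, sum_eq_sum_subtype (sccOf G c)]
      · refine Finset.sum_congr rfl fun k _ => ?_
        have h1 : (k.1 ≠ i.1 ∧ G i.1 k.1) ↔ (k ≠ i ∧ induced G (sccOf G c) i k) :=
          and_congr (not_congr Subtype.ext_iff.symm) Iff.rfl
        rw [hin i k]
        simp only [h1]
      · intro k hk
        rw [hout i k hk, ite_self]
    have h2 : (i.1 = j.1) ↔ i = j := Subtype.ext_iff.symm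
    have h3 : G i.1 j.1 ↔ induced G (sccOf G c) i j := Iff.rfl
    simp only [weightMatrix, Matrix.of_apply, hin i j, h2, h3]
    split_ifs
    · congr 1
      convert hsum
    · rfl
    · rfl
  have hWout : ∀ (i : sccOf G c) j, j ∉ sccOf G c → weightMatrix G w i j = 0 := by
    intro i j hj
    have hij : i.1 ≠ j := fun h => hj (h ▸ i.2)
    simp [weightMatrix, hij, hout i j hj]
  have h0 := hwc c a (fun i => V i.1) (fun i x => by
    rw [← hV i.1 x, sum_eq_sum_subtype (sccOf G c)]
    · simp only [hWin]
    · intro j hj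
      rw [hWout i j hj, Complex.ofReal_zero, zero_mul]) fun i => hVM i.1
  exact congrFun (congrFun h0 ⟨i₀, (hmem i₀).2 rfl⟩) x₀

/-- If the states of `Y` can be chosen as outputs such that the kernel of a matrix with the given
pattern is observed, then this holds for almost all matrices with this pattern. -/
lemma ae_injective_of_perm (E : X → X → Prop) (Y : Set X) (π : Equiv.Perm X)
    (hπ : ∀ j, j ∈ Y ∨ E (π j) j) :
    ∀ᵐ a : X → X → ℝ, ∀ z : X → ℂ, cplx (systemMatrix E a) *ᵥ z = 0 → (∀ x ∈ Y, z x = 0) →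
      z = 0 := by
  classical
  -- For the zero dynamics only the power zero counts, so observability is injectivity of the output
  -- matrix, and `ae_isObservable` applies to it.
  have hiff : ∀ a : X → X → ℝ, IsObservable (0 : Matrix X X ℝ)
      (Matrix.fromRows (systemMatrix E a) (indicatorMatrix Y ℝ)) ↔
      ∀ z : X → ℝ, systemMatrix E a *ᵥ z = 0 → (∀ x ∈ Y, z x = 0) → z = 0 := by
    intro a
    constructor
    · intro h z hz hzY
      refine h z fun k _ => ?_
      rw [← Matrix.mulVec_mulVec]
      cases k with
      | zero =>
        rw [pow_zero, Matrix.one_mulVec, Matrix.fromRows_mulVec, hz,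
          (indicatorMatrix_mulVec_eq_zero Y z).2 hzY]
        exact Sum.elim_zero_zero
      | succ k => rw [pow_succ, mul_zero, Matrix.zero_mulVec, Matrix.mulVec_zero]
    · intro h z hz
      rcases isEmpty_or_nonempty X with hX | hX
      · exact Subsingleton.elim _ _
      have h0 := hz 0 Fintype.card_pos
      rw [pow_zero, Matrix.mul_one, Matrix.fromRows_mulVec] at h0
      exact h z (funext fun x => congrFun h0 (Sum.inl x))
        ((indicatorMatrix_mulVec_eq_zero Y z).1 (funext fun x => congrFun h0 (Sum.inr x)))
  have hpoint : IsObservable (0 : Matrix X X ℝ) (Matrix.fromRows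
      (systemMatrix E fun i j => if i = π j then 1 else 0) (indicatorMatrix Y ℝ)) := by
    rw [hiff]
    intro z hz hzY
    ext j
    rcases hπ j with hj | hj
    · exact hzY j hj
    · have h1 := congrFun hz (π j)
      rw [Matrix.mulVec, dotProduct, Finset.sum_eq_single j] at h1
      · simpa [systemMatrix, hj] using h1
      · intro b _ hb
        simp [systemMatrix, hb.symm]
      · simp
  have hmap : ∀ a : X → X → ℝ,
      (Matrix.fromRows (universalMatrix E (entry (X := X)))
        (indicatorMatrix Y (polyFn (X → X → ℝ)))).map (polyFn.ev a) =
      Matrix.fromRows (systemMatrix E a) (indicatorMatrix Y ℝ) := by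
    intro a
    rw [Matrix.fromRows_map, universalMatrix_map, indicatorMatrix_map]
    rfl
  have hzero : ∀ a : X → X → ℝ,
      (0 : Matrix X X (polyFn (X → X → ℝ))).map (polyFn.ev a) = 0 := fun a =>
    Matrix.map_zero _ (map_zero _)
  have hae := ae_isObservable (volume : Measure (X → X → ℝ)) 0
    (Matrix.fromRows (universalMatrix E (entry (X := X)))
        (indicatorMatrix Y (polyFn (X → X → ℝ)))) (fun i j => if i = π j then 1 else 0) (by
      rw [hmap, hzero]; exact hpoint)
  filter_upwards [hae] with a ha
  rw [hmap, hzero, hiff] at ha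
  intro z hz hzY
  have hre := ha (fun x => (z x).re) (by rw [mulVec_re, hz]; rfl)
    fun x hx => by simp only [hzY x hx, Complex.zero_re]
  have him := ha (fun x => (z x).im) (by rw [mulVec_im, hz]; rfl)
    fun x hx => by simp only [hzY x hx, Complex.zero_im]
  ext x
  exact Complex.ext (congrFun hre x) (congrFun him x)

end

/-! ### Lebesgue measure on the parameter space -/

lemma isAddHaarMeasure_volume_pi {κ : Type*} [Fintype κ] {V : κ → Type*} [∀ i, AddGroup (V i)]
    [∀ i, TopologicalSpace (V i)] [∀ i, MeasureSpace (V i)]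
    [∀ i, SigmaFinite (volume : Measure (V i))]
    [∀ i, (volume : Measure (V i)).IsAddHaarMeasure] [∀ i, MeasurableAdd (V i)] :
    (volume : Measure ((i : κ) → V i)).IsAddHaarMeasure :=
  inferInstanceAs (Measure.pi fun _ => volume).IsAddHaarMeasure

instance isAddHaarMeasure_volume_parameters {ι X : Type*} [Fintype ι] [Fintype X] {p : ι → ℕ} :
    (volume : Measure ((X → X → ℝ) × (ι → ι → ℝ) ×
      ((i : ι) → Fin (p i) → ℝ))).IsAddHaarMeasure := by
  have h₁ : (volume : Measure (X → X → ℝ)).IsAddHaarMeasure := isAddHaarMeasure_volume_pi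
  have h₂ : (volume : Measure (ι → ι → ℝ)).IsAddHaarMeasure := isAddHaarMeasure_volume_pi
  have h₃ : (volume : Measure ((i : ι) → Fin (p i) → ℝ)).IsAddHaarMeasure :=
    isAddHaarMeasure_volume_pi
  have h₄ : (volume : Measure ((ι → ι → ℝ) × ((i : ι) → Fin (p i) → ℝ))).IsAddHaarMeasure :=
    Measure.prod.instIsAddHaarMeasure _ _
  exact Measure.prod.instIsAddHaarMeasure _ _

/-! ### Measurements and the full networked system -/

section

variable {ι X : Type*} [Fintype ι]

/-- The states that are measured by the neighbors of an agent. -/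
def measuredStates (Gα : ι → ι → Prop) {p : ι → ℕ} (s : (i : ι) → Fin (p i) → X) (i : ι) : Set X :=
  {x | ∃ j ∈ nbhd Gα i, ∃ r, s j r = x}

variable [DecidableEq ι] [Fintype X] [DecidableEq X]

/-- Each measurement sees one state, so `DH` is diagonal; with unit coefficients its entries count
the measurements of a state in the neighborhood, and nothing cancels. -/
lemma DH_mulVec_eq_zero (Gα : ι → ι → Prop) {p : ι → ℕ} (s : (i : ι) → Fin (p i) → X)
    (v : ι × X → ℝ) : DH Gα (measurementMatrix s fun _ _ => 1) *ᵥ v = 0 ↔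
      ∀ y ∈ {q : ι × X | q.2 ∈ measuredStates Gα s q.1}, v y = 0 := by
  classical
  set d : ι × X → ℝ := fun q => ∑ j ∈ Finset.univ.filter (fun j => j ∈ nbhd Gα q.1),
    ∑ r, if q.2 = s j r then (1 : ℝ) else 0 with hd
  have hdiag : DH Gα (measurementMatrix s fun _ _ => 1) = Matrix.diagonal d := by
    ext ⟨i, x⟩ ⟨j, y⟩
    by_cases hij : i = j
    · subst hij
      by_cases hxy : x = y
      · subst hxy
        rw [Matrix.diagonal_apply_eq]
        simp only [DH, Matrix.of_apply, if_true, Matrix.sum_apply, hd, Matrix.mul_apply,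
          Matrix.transpose_apply, measurementMatrix, mul_ite, mul_one, mul_zero]
        refine Finset.sum_congr (by congr!) fun j _ => Finset.sum_congr rfl fun r _ => ?_
        split_ifs <;> rfl
      · have hne : ((i, x) : ι × X) ≠ (i, y) := fun h => hxy (Prod.ext_iff.1 h).2
        rw [Matrix.diagonal_apply_ne _ hne]
        simp only [DH, Matrix.of_apply, if_true, Matrix.sum_apply, Matrix.mul_apply,
          Matrix.transpose_apply, measurementMatrix]
        refine Finset.sum_eq_zero fun j _ => Finset.sum_eq_zero fun r _ => ?_
        by_cases hx : x = s j r
        · rw [if_neg (fun hy : y = s j r => hxy (hx.trans hy.symm)), mul_zero]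
        · rw [if_neg hx, zero_mul]
    · have hne : ((i, x) : ι × X) ≠ (j, y) := fun h => hij (Prod.ext_iff.1 h).1
      rw [Matrix.diagonal_apply_ne _ hne]
      simp [DH, hij]
  have hd0 : ∀ q : ι × X, q.2 ∈ measuredStates Gα s q.1 ↔ d q ≠ 0 := by
    intro q
    have hnonneg : ∀ j, 0 ≤ ∑ r, if q.2 = s j r then (1 : ℝ) else 0 := fun j =>
      Finset.sum_nonneg fun r _ => by split_ifs <;> norm_num
    constructor
    · rintro ⟨j, hj, r, hr⟩
      refine (Finset.sum_pos' (fun j _ => hnonneg j) ⟨j, by simpa using hj, ?_⟩).ne'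
      exact Finset.sum_pos' (fun r _ => by split_ifs <;> norm_num)
        ⟨r, Finset.mem_univ _, by simp [hr]⟩
    · intro h
      obtain ⟨j, hj, hne⟩ := Finset.exists_ne_zero_of_sum_ne_zero h
      obtain ⟨r, -, hne⟩ := Finset.exists_ne_zero_of_sum_ne_zero hne
      refine ⟨j, by simpa using hj, r, ?_⟩
      by_contra hr
      exact hne (if_neg fun h => hr h.symm)
  rw [hdiag]
  constructor
  · intro h q hq
    have h1 := congrFun h q
    rw [Matrix.mulVec_diagonal] at h1
    exact (mul_eq_zero.1 h1).resolve_left ((hd0 q).1 hq)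
  · intro h
    ext q
    rw [Matrix.mulVec_diagonal]
    by_cases hq : d q = 0
    · rw [hq, zero_mul]; rfl
    · rw [h q ((hd0 q).2 hq), mul_zero]; rfl

/-- Observability of the networked system for some values of the parameters. -/
lemma exists_isObservable (E : X → X → Prop) (Gα Gβ : ι → ι → Prop)
    {p : ι → ℕ} (s : (i : ι) → Fin (p i) → X)
    (hα : ∀ i : ι, ∀ C : Set X, IsContraction E C → ∃ j ∈ nbhd Gα i, Measures s j C)
    (hβ : ∀ i : ι, ∀ S : Set X, IsParentSCC E S →
      ∃ j : ι, Measures s j S ∧ HasPath Gβ j i ∧ HasPath Gβ i j) :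
    ∃ (a : X → X → ℝ) (w : ι → ι → ℝ), IsObservable (weightMatrix Gβ w ⊗ₖ systemMatrix E a)
      (DH Gα (measurementMatrix s fun _ _ => 1)) := by
  have hperm : ∀ i, ∃ π : Equiv.Perm X, ∀ j, j ∈ measuredStates Gα s i ∨ E (π j) j := by
    intro i
    refine exists_perm_of_contraction E _ fun C hC => ?_
    obtain ⟨j, hj, r, hr⟩ := hα i C hC
    exact ⟨s j r, ⟨j, hj, r, rfl⟩, hr⟩
  choose π hπ using hperm
  have hker : ∀ᵐ a : X → X → ℝ, ∀ i, ∀ z : X → ℂ, cplx (systemMatrix E a) *ᵥ z = 0 →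
      (∀ x ∈ measuredStates Gα s i, z x = 0) → z = 0 :=
    ae_all_iff.2 fun i => ae_injective_of_perm E _ (π i) (hπ i)
  have hno : ∀ᵐ a : X → X → ℝ, ∀ c,
      NoHidden (systemMatrix E a) (⋃ i ∈ sccOf Gβ c, measuredStates Gα s i) := by
    refine ae_all_iff.2 fun c => ?_
    have hsub : ∀ i ∈ sccOf Gβ c, ∀ x ∈ measuredStates Gα s i,
        x ∈ ⋃ i ∈ sccOf Gβ c, measuredStates Gα s i := fun i hi x hx =>
      Set.mem_biUnion hi hx
    -- The permutation of the single agent `c` suffices; the two-way paths of (ii) place the agents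
    -- measuring parent components in the component of `c`.
    obtain ⟨A, hA, hAno⟩ := exists_noHidden E (⋃ i ∈ sccOf Gβ c, measuredStates Gα s i) (π c)
      (fun j => (hπ c j).imp_left
        (hsub c ⟨Relation.ReflTransGen.refl, Relation.ReflTransGen.refl⟩ j))
      (exists_hasPath_of_parentSCC E _ fun S hS => by
        obtain ⟨j, ⟨r, hr⟩, hjc, hcj⟩ := hβ c S hS
        exact ⟨s j r, hsub j ⟨hcj, hjc⟩ _ ⟨j, Or.inl rfl, r, rfl⟩, hr⟩)
    have := ae_noHidden (volume : Measure (X → X → ℝ)) (universalMatrix E (entry (X := X)))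
      (⋃ i ∈ sccOf Gβ c, measuredStates Gα s i) (fun x y => A x y) (by
        rw [universalMatrix_map]
        exact (systemMatrix_of_pattern hA).symm ▸ hAno)
    simp only [universalMatrix_map] at this
    exact this
  -- Genericity provides one `A` that serves all agents and all components at once.
  obtain ⟨a, hak, han⟩ := (hker.and hno).exists
  obtain ⟨w, hw⟩ := exists_weights Gβ (systemMatrix E a) (measuredStates Gα s) hak han
  refine ⟨a, w, (isObservable_iff_noHidden _ _ _ (DH_mulVec_eq_zero Gα s)).2 ?_⟩
  intro c z hz hzM
  have h0 := hw c (fun i x => z (i, x)) (fun i x => by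
    have h1 : ∑ q : ι × X, cplx (weightMatrix Gβ w ⊗ₖ systemMatrix E a) (i, x) q * z q =
        c * z (i, x) := congrFun hz (i, x)
    rw [← h1, Fintype.sum_prod_type]
    refine Finset.sum_congr rfl fun j _ => ?_
    simp only [Matrix.mulVec, dotProduct, Finset.mul_sum]
    refine Finset.sum_congr rfl fun y _ => ?_
    simp [Matrix.kroneckerMap_apply, mul_assoc]) fun i x hx => hzM (i, x) hx
  ext q
  exact congrFun (congrFun h0 q.1) q.2

open Classical in
/-- Observability of the networked system is a generic property of its parameters. -/
lemma ae_isObservable_of_exists (E : X → X → Prop) (Gα Gβ : ι → ι → Prop)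
    {p : ι → ℕ} (s : (i : ι) → Fin (p i) → X)
    (θ₀ : (X → X → ℝ) × (ι → ι → ℝ) × ((i : ι) → Fin (p i) → ℝ))
    (h : IsObservable (weightMatrix Gβ θ₀.2.1 ⊗ₖ systemMatrix E θ₀.1)
      (DH Gα (measurementMatrix s θ₀.2.2))) :
    ∀ᵐ θ : (X → X → ℝ) × (ι → ι → ℝ) × ((i : ι) → Fin (p i) → ℝ) ∂volume,
      IsObservable (weightMatrix Gβ θ.2.1 ⊗ₖ systemMatrix E θ.1)
        (DH Gα (measurementMatrix s θ.2.2)) := by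
  let Θ := (X → X → ℝ) × (ι → ι → ℝ) × ((i : ι) → Fin (p i) → ℝ)
  let φa : X → X → Θ →ₗ[ℝ] ℝ := fun x y => (entry x y).comp (LinearMap.fst ℝ _ _)
  let φw : ι → ι → Θ →ₗ[ℝ] ℝ := fun i j =>
    (entry i j).comp ((LinearMap.fst ℝ _ _).comp (LinearMap.snd ℝ _ _))
  let φh : (i : ι) → Fin (p i) → Θ →ₗ[ℝ] ℝ := fun i r =>
    { toFun := fun θ => θ.2.2 i r
      map_add' := fun _ _ => rfl
      map_smul' := fun _ _ => rfl }
  let Wp : Matrix ι ι (polyFn Θ) := Matrix.of fun i j =>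
    if i = j then 1 - ∑ k ∈ Finset.univ.filter (fun k => k ≠ i ∧ Gβ i k), polyFn.lin (φw i k)
    else if Gβ i j then polyFn.lin (φw i j) else 0
  let Hp : (i : ι) → Matrix (Fin (p i)) X (polyFn Θ) := fun i => Matrix.of fun r x =>
    if x = s i r then polyFn.lin (φh i r) else 0
  let Fp : Matrix (ι × X) (ι × X) (polyFn Θ) := Wp ⊗ₖ universalMatrix E φa
  let Gp : Matrix (ι × X) (ι × X) (polyFn Θ) := Matrix.of fun a b =>
    if a.1 = b.1 then
      (∑ j ∈ Finset.univ.filter (fun j => j ∈ nbhd Gα a.1), (Hp j)ᵀ * Hp j) a.2 b.2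
    else 0
  have hF : ∀ θ : Θ, Fp.map (polyFn.ev θ) = weightMatrix Gβ θ.2.1 ⊗ₖ systemMatrix E θ.1 := by
    intro θ
    have hW : ∀ i j, polyFn.ev θ (Wp i j) = weightMatrix Gβ θ.2.1 i j := by
      intro i j
      simp only [Wp, weightMatrix, Matrix.of_apply]
      split_ifs
      · rw [map_sub, map_one, map_sum]
        congr 1
        exact Finset.sum_congr (by congr!) fun k _ => rfl
      · rfl
      · exact map_zero _
    ext ⟨i, x⟩ ⟨j, y⟩
    have h1 := congrFun (congrFun (universalMatrix_map E φa θ) x) y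
    simp only [Matrix.map_apply] at h1
    simp only [Fp, Matrix.map_apply, Matrix.kroneckerMap_apply, map_mul, hW, h1]
    rfl
  have hGm : ∀ θ : Θ, Gp.map (polyFn.ev θ) = DH Gα (measurementMatrix s θ.2.2) := by
    intro θ
    have hH : ∀ i r x, polyFn.ev θ (Hp i r x) = measurementMatrix s θ.2.2 i r x := by
      intro i r x
      simp only [Hp, measurementMatrix, Matrix.of_apply]
      split_ifs
      · rfl
      · exact map_zero _
    ext ⟨i, x⟩ ⟨j, y⟩
    simp only [Gp, DH, Matrix.map_apply, Matrix.of_apply]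
    split_ifs
    · simp only [Matrix.sum_apply, Matrix.mul_apply, Matrix.transpose_apply, map_sum, map_mul, hH]
    · exact map_zero _
  have : (volume : Measure Θ).IsAddHaarMeasure := isAddHaarMeasure_volume_parameters
  have := ae_isObservable (volume : Measure Θ) Fp Gp θ₀ (by rw [hF, hGm]; exact h)
  simpa only [hF, hGm] using this

lemma weightMatrix_sum_row (Gβ : ι → ι → Prop) (w : ι → ι → ℝ) (i : ι) :
    ∑ j, weightMatrix Gβ w i j = 1 := by
  classical
  rw [← Finset.add_sum_erase _ _ (Finset.mem_univ i)]
  have h1 : ∑ j ∈ Finset.univ.erase i, weightMatrix Gβ w i j =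
      ∑ k ∈ Finset.univ.filter (fun k => k ≠ i ∧ Gβ i k), w i k := by
    symm
    refine Finset.sum_subset_zero_on_sdiff (fun k hk => ?_) (fun k hk => ?_) fun k hk => ?_
    · exact Finset.mem_erase.2 ⟨(Finset.mem_filter.1 hk).2.1, Finset.mem_univ k⟩
    · obtain ⟨hk1, hk2⟩ := Finset.mem_sdiff.1 hk
      have hki := (Finset.mem_erase.1 hk1).1
      have hG : ¬ Gβ i k := fun h => hk2 (Finset.mem_filter.2 ⟨Finset.mem_univ k, hki, h⟩)
      simp [weightMatrix, hki.symm, hG]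
    · obtain ⟨-, hki, hG⟩ := Finset.mem_filter.1 hk
      simp [weightMatrix, hki.symm, hG]
  rw [h1]
  have h2 : weightMatrix Gβ w i i =
      1 - ∑ k ∈ Finset.univ.filter (fun k => k ≠ i ∧ Gβ i k), w i k := by
    simp only [weightMatrix, Matrix.of_apply, if_true]
    congr!
  rw [h2, sub_add_cancel]

/-- At most `card ι` weights, each below `1 / (card ι + 1)`, sum to less than one. -/
lemma weightMatrix_diag_pos (Gβ : ι → ι → Prop) (w : ι → ι → ℝ)
    (hw : ∀ i j, w i j < 1 / (Fintype.card ι + 1)) (i : ι) : 0 < weightMatrix Gβ w i i := by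
  classical
  have h2 : weightMatrix Gβ w i i =
      1 - ∑ k ∈ Finset.univ.filter (fun k => k ≠ i ∧ Gβ i k), w i k := by
    simp only [weightMatrix, Matrix.of_apply, if_true]
    congr!
  rw [h2, sub_pos]
  set n : ℝ := (Fintype.card ι : ℝ) with hn
  have hn0 : 0 ≤ n := Nat.cast_nonneg _
  calc ∑ k ∈ Finset.univ.filter (fun k => k ≠ i ∧ Gβ i k), w i k
      ≤ ∑ k ∈ Finset.univ.filter (fun k => k ≠ i ∧ Gβ i k), 1 / (n + 1) :=
        Finset.sum_le_sum fun k _ => (hw i k).le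
    _ ≤ ∑ k : ι, 1 / (n + 1) := Finset.sum_le_sum_of_subset_of_nonneg (Finset.filter_subset _ _)
        fun _ _ _ => by positivity
    _ = n / (n + 1) := by
        rw [Finset.sum_const, Finset.card_univ, nsmul_eq_mul, mul_one_div]
    _ < 1 := by rw [div_lt_one (by linarith)]; linarith

end

end CyberSocial

theorem theorem3 {ι X : Type*} [Fintype ι] [DecidableEq ι] [Fintype X] [DecidableEq X]
    -- the social digraph, the measurement-sharing and the prediction-sharing network
    (E : X → X → Prop) (Gα Gβ : ι → ι → Prop)
    -- the measurements: the `r`-th measurement of agent `i` is of the state `s i r`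
    {p : ι → ℕ} (s : (i : ι) → Fin (p i) → X)
    -- (i) direct links from Type-α agents
    (hα : ∀ i : ι, ∀ C : Set X, CyberSocial.IsContraction E C →
      ∃ j ∈ CyberSocial.nbhd Gα i, CyberSocial.Measures s j C)
    -- (ii) paths of prediction-sharing links from (and back to) Type-β agents
    (hβ : ∀ i : ι, ∀ S : Set X, CyberSocial.IsParentSCC E S →
      ∃ j : ι, CyberSocial.Measures s j S ∧
        CyberSocial.HasPath Gβ j i ∧ CyberSocial.HasPath Gβ i j) :
    CyberSocial.IsStructurallyObservable E Gα Gβ s := by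
  obtain ⟨a₀, w₀, h₀⟩ := CyberSocial.exists_isObservable E Gα Gβ s hα hβ
  have hae := CyberSocial.ae_isObservable_of_exists E Gα Gβ s (a₀, w₀, fun _ _ => 1) h₀
  refine ⟨?_, hae⟩
  -- In this box every free parameter is nonzero and the weight matrix is stochastic with positive
  -- diagonal; being open and nonempty, it meets the dense set of observable parameters.
  have hopen : IsOpen ((Set.pi Set.univ fun _ : X => Set.pi Set.univ fun _ : X => Set.Ioi (0 : ℝ))
      ×ˢ ((Set.pi Set.univ fun _ : ι => Set.pi Set.univ fun _ : ι =>
        Set.Ioo (0 : ℝ) (1 / (Fintype.card ι + 1))) ×ˢ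
      (Set.pi Set.univ fun i : ι => Set.pi Set.univ fun _ : Fin (p i) => Set.Ioi (0 : ℝ)))) := by
    refine IsOpen.prod ?_ (IsOpen.prod ?_ ?_) <;>
      refine isOpen_set_pi Set.finite_univ fun _ _ => isOpen_set_pi Set.finite_univ fun _ _ => ?_
    · exact isOpen_Ioi
    · exact isOpen_Ioo
    · exact isOpen_Ioi
  have hpos : (0 : ℝ) < 1 / (Fintype.card ι + 1) := by positivity
  obtain ⟨⟨a, w, h⟩, ⟨ha, hw, hh⟩, hobs⟩ :=
    (Measure.dense_of_ae hae).inter_open_nonempty _ hopen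
      ⟨(fun _ _ => 1, fun _ _ => 1 / (Fintype.card ι + 1) / 2, fun _ _ => 1),
        fun _ _ _ _ => Set.mem_Ioi.2 one_pos,
        fun _ _ _ _ => ⟨half_pos hpos, half_lt_self hpos⟩,
        fun _ _ _ _ => Set.mem_Ioi.2 one_pos⟩
  replace ha : ∀ x y, 0 < a x y := fun x y => ha x trivial y trivial
  replace hw : ∀ i j, 0 < w i j ∧ w i j < 1 / (Fintype.card ι + 1) := fun i j =>
    hw i trivial j trivial
  replace hh : ∀ i r, 0 < h i r := fun i r => hh i trivial r trivial
  have hdiag := CyberSocial.weightMatrix_diag_pos Gβ w fun i j => (hw i j).2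
  refine ⟨CyberSocial.systemMatrix E a, CyberSocial.weightMatrix Gβ w,
    CyberSocial.measurementMatrix s h, fun x y => ?_, ?_, fun i j => ?_, fun i r x => ?_, hobs⟩
  · by_cases hE : E x y <;> simp [CyberSocial.systemMatrix, hE, (ha x y).ne']
  · rw [mem_rowStochastic]
    refine ⟨fun i j => ?_, ?_⟩
    · by_cases hij : i = j
      · exact hij ▸ (hdiag i).le
      · by_cases hG : Gβ i j <;> simp [CyberSocial.weightMatrix, hij, hG, (hw i j).1.le]
    · ext i
      simpa [Matrix.mulVec, dotProduct] using CyberSocial.weightMatrix_sum_row Gβ w i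
  · by_cases hij : i = j
    · subst hij
      exact iff_of_true (hdiag i).ne' (Or.inl rfl)
    · have hji : j ≠ i := fun h => hij h.symm
      by_cases hG : Gβ i j <;>
        simp [CyberSocial.weightMatrix, CyberSocial.nbhd, hij, hji, hG, (hw i j).1.ne']
  · by_cases hx : x = s i r <;> simp [CyberSocial.measurementMatrix, hx, (hh i r).ne']
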